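/- For a graph $F$, let $\kappa(F)$ be its simplex graph: its vertices are the finite cliques of $F$ (including the empty one), and two cliques are adjacent when they differ by the presence or absence of exactly one vertex of $F$. A partial double tree is a connected graph that embeds isometrically into the Cartesian product of two trees. For a graph $G$, let $|G|$ be the cube complex obtained by replacing every induced hypercube of $G$ (vertex, edge, induced $4$-cycle, etc.) by a solid unit cube of the same dimension, endowed with the intrinsic $l_1$-metric. A dendron is a complete Menger-convex metric space in which any two distinct points are joined by a unique arc; it is finite if it is compact and has finitely many leaves (points whose removal does not separate any pair of points) and ramification points (points whose removal creates at least three arc-connected components). A ramified rectilinear polygon is a finite rectangular complex (cells: vertices, edges and axis-parallel rectangles, any two of which are disjoint or meet in a common face) endowed with the intrinsic $l_1$-metric that embeds isometrically into the product of two finite dendrons, where distances in the product are the sums of the distances of the coordinates. Theorem 6. For every group $\Gamma$ there is a graph $F$ with $\operatorname{Aut}(F)\cong\Gamma$, finite if $\Gamma$ is finite, such that the graph $G=\kappa(\kappa(F))$ has the following properties: $\operatorname{Aut}(G)\cong\Gamma$; $G$ is a $2$-connected partial double tree of radius $2$; $G$ is finite if $\Gamma$ is finite; $\operatorname{Aut}(G)$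 is isomorphic to the group of isometries of $|G|$; and, if $G$ is finite, then $|G|$ is a ramified rectilinear polygon without cutpoints. -/

import Mathlib

open scoped ENNReal

universe u

/-! ### Graphs -/

/-- The simplex graph `κ(F)`: its vertices are the (finite) cliques of `F`, including the empty
one; two cliques are adjacent when they differ by the presence or absence of exactly one vertex. -/
def simplexGraph {V : Type u} (F : SimpleGraph V) :
    SimpleGraph {s : Finset V // F.IsClique (s : Set V)} where
  Adj s t := ∃ v : V, symmDiff (s.1 : Set V) (t.1 : Set V) = {v}
  symm := ⟨fun s t ⟨v, hv⟩ => ⟨v, by rw [symmDiff_comm]; exact hv⟩⟩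
  loopless := ⟨fun s ⟨v, hv⟩ => by
    rw [symmDiff_self] at hv
    exact (Set.singleton_nonempty v).ne_empty hv.symm⟩

/-- `G` is `2`-connected: it is connected, has at least three vertices, and stays connected after
the deletion of any single vertex. -/
def IsTwoConnected {V : Type u} (G : SimpleGraph V) : Prop :=
  G.Connected ∧ 3 ≤ ENat.card V ∧ ∀ v : V, (G.induce {v}ᶜ).Connected

/-- A partial double tree: a connected graph that embeds isometrically (for the graph metrics)
into the Cartesian product of two trees. -/
def IsPartialDoubleTree {V : Type u} (G : SimpleGraph V) : Prop :=
  G.Connected ∧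
    ∃ (A B : Type u) (T₁ : SimpleGraph A) (T₂ : SimpleGraph B),
      T₁.IsTree ∧ T₂.IsTree ∧
        ∃ f : V → A × B, ∀ x y : V, (T₁.boxProd T₂).dist (f x) (f y) = G.dist x y

/-- The hypercube `Q_n`: vertices are `0/1`-words of length `n`, adjacent when they differ in
exactly one position. -/
def hypercubeGraph (n : ℕ) : SimpleGraph (Fin n → Bool) where
  Adj a b := hammingDist a b = 1
  symm := ⟨fun a b h => by rw [hammingDist_comm]; exact h⟩
  loopless := ⟨fun a h => by simp at h⟩

/-! ### Box complexes and their intrinsic `l₁`-metric -/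

/-- A cell of a box complex on the set of points `X`: an axis-parallel box `∏ i, [0, side i]`
together with its characteristic map into `X`. Vertices are the cells of dimension `0`, edges
those of dimension `1` and rectangles those of dimension `2`. -/
structure BoxCell (X : Type u) where
  dim : ℕ
  side : Fin dim → ℝ
  side_pos : ∀ i, 0 < side i
  chart : (∀ i, Set.Icc (0 : ℝ) (side i)) → X

namespace BoxCell

variable {X : Type u}

/-- The set of points of a cell. -/
def carrier (C : BoxCell X) : Set X := Set.range C.chart

/-- The face of a cell in which the `i`-th coordinate is free if `φ i = none`, is `0` if
`φ i = some false`, and is `side i` if `φ i = some true`. -/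
def face (C : BoxCell X) (φ : Fin C.dim → Option Bool) : Set X :=
  C.chart '' {s | ∀ i, (φ i = some false → (s i : ℝ) = 0) ∧
    (φ i = some true → (s i : ℝ) = C.side i)}

/-- The `l₁`-distance of two points measured inside the cell (`∞` unless both lie in it). -/
noncomputable def localEDist (C : BoxCell X) (x y : X) : ℝ≥0∞ :=
  ⨅ (s : ∀ i, Set.Icc (0 : ℝ) (C.side i)) (t : ∀ i, Set.Icc (0 : ℝ) (C.side i))
    (_ : C.chart s = x) (_ : C.chart t = y), ∑ i, edist (s i) (t i)

lemma localEDist_comm (C : BoxCell X) (x y : X) : C.localEDist x y = C.localEDist y x := by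
  have key : ∀ x y : X, C.localEDist x y ≤ C.localEDist y x := by
    intro x y
    refine le_iInf fun s => le_iInf fun t => le_iInf fun hs => le_iInf fun ht => ?_
    refine (iInf_le_of_le t <| iInf_le_of_le s <| iInf_le_of_le ht <| iInf_le_of_le hs le_rfl).trans
      (Finset.sum_le_sum fun i _ => (edist_comm _ _).le)
  exact le_antisymm (key x y) (key y x)

end BoxCell

/-- The intrinsic `l₁`-metric of a family of cells: the infimum of the lengths
`∑ d(x_i, x_{i+1})` over all finite sequences `x = x_0, x_1, …, x_n = y` of points such that
`x_i` and `x_{i+1}` lie in a common cell, in which `d(x_i, x_{i+1})` is computed. -/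
noncomputable def intrinsicEDist {X : Type u} (K : Set (BoxCell X)) (x y : X) : ℝ≥0∞ :=
  ⨅ (n : ℕ) (p : ℕ → X) (_ : p 0 = x) (_ : p n = y),
    ∑ i ∈ Finset.range n, ⨅ C ∈ K, C.localEDist (p i) (p (i + 1))

section intrinsic

variable {X : Type u} (K : Set (BoxCell X))

lemma intrinsicEDist_self (x : X) : intrinsicEDist K x x = 0 := by
  refine le_antisymm ?_ bot_le
  exact iInf_le_of_le 0 <| iInf_le_of_le (fun _ => x) <| iInf_le_of_le rfl <|
    iInf_le_of_le rfl (by simp)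

lemma intrinsicEDist_comm (x y : X) : intrinsicEDist K x y = intrinsicEDist K y x := by
  have key : ∀ x y : X, intrinsicEDist K x y ≤ intrinsicEDist K y x := by
    intro x y
    refine le_iInf fun n => le_iInf fun p => le_iInf fun h0 => le_iInf fun hn => ?_
    refine iInf_le_of_le n <| iInf_le_of_le (fun i => p (n - i)) <| iInf_le_of_le (by simpa using hn)
      <| iInf_le_of_le (by simpa using h0) ?_
    rw [← Finset.sum_range_reflect]
    refine Finset.sum_le_sum fun i hi => ?_
    have hi' : i < n := Finset.mem_range.1 hi
    have e1 : n - (n - 1 - i) = i + 1 := by omega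
    have e2 : n - (n - 1 - i + 1) = i := by omega
    beta_reduce
    rw [e1, e2]
    exact iInf₂_mono fun C _ => (C.localEDist_comm _ _).le
  exact le_antisymm (key x y) (key y x)

lemma intrinsicEDist_triangle (x y z : X) :
    intrinsicEDist K x z ≤ intrinsicEDist K x y + intrinsicEDist K y z := by
  have key : ∀ (n : ℕ) (p : ℕ → X), p 0 = x → p n = y → ∀ (m : ℕ) (q : ℕ → X), q 0 = y → q m = z →
      intrinsicEDist K x z ≤
        ∑ i ∈ Finset.range n, (⨅ C ∈ K, C.localEDist (p i) (p (i + 1))) +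
          ∑ i ∈ Finset.range m, (⨅ C ∈ K, C.localEDist (q i) (q (i + 1))) := by
    intro n p hp0 hpn m q hq0 hqm
    have h0 : (if 0 ≤ n then p 0 else q (0 - n)) = x := by simpa using hp0
    have h1 : (if n + m ≤ n then p (n + m) else q (n + m - n)) = z := by
      rcases Nat.eq_zero_or_pos m with rfl | hm
      · simp [hpn, ← hqm, hq0]
      · rw [if_neg (by omega), Nat.add_sub_cancel_left, hqm]
    refine iInf_le_of_le (n + m) <| iInf_le_of_le (fun i => if i ≤ n then p i else q (i - n)) <|
      iInf_le_of_le h0 <| iInf_le_of_le h1 ?_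
    rw [Finset.sum_range_add]
    refine add_le_add (Finset.sum_le_sum fun i hi => ?_) (Finset.sum_le_sum fun i hi => ?_)
    · have hi' : i < n := Finset.mem_range.1 hi
      beta_reduce
      rw [if_pos (by omega), if_pos (by omega)]
    · have e2 : n + i + 1 - n = i + 1 := by omega
      beta_reduce
      rw [if_neg (by omega : ¬ n + i + 1 ≤ n), e2]
      rcases Nat.eq_zero_or_pos i with rfl | hi'
      · simp [hpn, hq0]
      · rw [if_neg (by omega : ¬ n + i ≤ n), Nat.add_sub_cancel_left]
  have key2 : ∀ a b : ℝ≥0∞, intrinsicEDist K x y < a → intrinsicEDist K y z < b →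
      intrinsicEDist K x z ≤ a + b := by
    intro a b ha hb
    simp only [intrinsicEDist, iInf_lt_iff] at ha hb
    obtain ⟨n, p, h1, h2, ha⟩ := ha
    obtain ⟨m, q, h3, h4, hb⟩ := hb
    exact (key n p h1 h2 m q h3 h4).trans (add_le_add ha.le hb.le)
  by_cases hx : intrinsicEDist K x y = ⊤
  · simp [hx]
  by_cases hy : intrinsicEDist K y z = ⊤
  · simp [hy]
  refine ENNReal.le_of_forall_pos_le_add fun ε hε _ => ?_
  have hε2 : ((ε / 2 : NNReal) : ℝ≥0∞) ≠ 0 := by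
    have : (ε / 2 : NNReal) ≠ 0 := (half_pos hε).ne'
    exact_mod_cast this
  refine (key2 _ _ (ENNReal.lt_add_right hx hε2) (ENNReal.lt_add_right hy hε2)).trans (le_of_eq ?_)
  have : ((ε : NNReal) : ℝ≥0∞) = ((ε / 2 : NNReal) : ℝ≥0∞) + ((ε / 2 : NNReal) : ℝ≥0∞) := by
    rw [← ENNReal.coe_add, add_halves]
  rw [this]
  abel

end intrinsic

/-- A family `K` of cells exhibits the metric space `X` as a finite rectangular complex endowed
with its intrinsic `l₁`-metric. Several members of `K` may parametrize the same cell. -/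
structure IsFiniteRectangularComplex {X : Type u} [EMetricSpace X] (K : Set (BoxCell X)) :
    Prop where
  /-- cells are vertices, edges and rectangles -/
  dim_le : ∀ C ∈ K, C.dim ≤ 2
  /-- characteristic maps are one-to-one -/
  injective : ∀ C ∈ K, Function.Injective C.chart
  /-- there are finitely many cells -/
  finite : (BoxCell.carrier '' K).Finite
  /-- the cells cover the space -/
  cover : ∀ x : X, ∃ C ∈ K, x ∈ C.carrier
  /-- every face of a cell is a cell -/
  face_mem : ∀ C ∈ K, ∀ φ : Fin C.dim → Option Bool, ∃ D ∈ K, D.carrier = C.face φ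
  /-- two cells are disjoint or meet in a common face -/
  inter : ∀ C ∈ K, ∀ D ∈ K, (C.carrier ∩ D.carrier).Nonempty →
    ∃ (φ : Fin C.dim → Option Bool) (ψ : Fin D.dim → Option Bool),
      C.face φ = C.carrier ∩ D.carrier ∧ D.face ψ = C.carrier ∩ D.carrier
  /-- two cells induce the same metric on their intersection -/
  compatible : ∀ C ∈ K, ∀ D ∈ K, ∀ x ∈ C.carrier ∩ D.carrier, ∀ y ∈ C.carrier ∩ D.carrier,
    C.localEDist x y = D.localEDist x y
  /-- the metric of the space is the intrinsic `l₁`-metric -/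
  edist_eq : ∀ x y : X, edist x y = intrinsicEDist K x y

/-! ### Dendrons and ramified rectilinear polygons -/

/-- `A` is an arc joining `x` and `y`: a homeomorphic image of a segment with these ends. -/
def IsArc {D : Type u} [TopologicalSpace D] (A : Set D) (x y : D) : Prop :=
  ∃ γ : unitInterval → D, Topology.IsEmbedding γ ∧ γ 0 = x ∧ γ 1 = y ∧ Set.range γ = A

/-- A dendron: a complete Menger-convex metric space in which any two distinct points are joined
by a unique arc. -/
structure IsDendron (D : Type u) [MetricSpace D] : Prop where
  complete : CompleteSpace D
  menger_convex : ∀ x y : D, x ≠ y → ∃ z : D, z ≠ x ∧ z ≠ y ∧ dist x z + dist z y = dist x y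
  unique_arc : ∀ x y : D, x ≠ y → ∃! A : Set D, IsArc A x y

/-- A leaf: a point whose removal does not separate any pair of points. -/
def IsLeafPoint {D : Type u} [TopologicalSpace D] (p : D) : Prop :=
  ∀ x y : D, x ≠ p → y ≠ p → JoinedIn {p}ᶜ x y

/-- A ramification point: its removal creates at least three arc-connected components. -/
def IsRamificationPoint {D : Type u} [TopologicalSpace D] (p : D) : Prop :=
  ∃ x y z : D, x ≠ p ∧ y ≠ p ∧ z ≠ p ∧
    ¬ JoinedIn {p}ᶜ x y ∧ ¬ JoinedIn {p}ᶜ y z ∧ ¬ JoinedIn {p}ᶜ x z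

/-- A finite dendron: a compact dendron with finitely many leaves and ramification points. -/
structure IsFiniteDendron (D : Type u) [MetricSpace D] : Prop extends IsDendron D where
  compact : CompactSpace D
  finite_vertices : {p : D | IsLeafPoint p ∨ IsRamificationPoint p}.Finite

/-- A ramified rectilinear polygon: a finite rectangular complex with its intrinsic `l₁`-metric
that embeds isometrically into the product of two finite dendrons, the distance in the product
being the sum of the distances of the coordinates. -/
def IsRamifiedRectilinearPolygon {X : Type u} [EMetricSpace X] (K : Set (BoxCell X)) : Prop :=
  IsFiniteRectangularComplex K ∧
    ∃ (D₁ D₂ : Type u) (_ : MetricSpace D₁) (_ : MetricSpace D₂),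
      IsFiniteDendron D₁ ∧ IsFiniteDendron D₂ ∧
        ∃ (f₁ : X → D₁) (f₂ : X → D₂), ∀ x y : X,
          edist x y = edist (f₁ x) (f₁ y) + edist (f₂ x) (f₂ y)

/-- A topological space has no cutpoints: the removal of any point leaves it connected. -/
def HasNoCutpoints (X : Type u) [TopologicalSpace X] : Prop :=
  ∀ p : X, IsConnected ({p}ᶜ : Set X)

/-! ### The geometric realization of a graph -/

section realization

variable {V : Type u}

open Classical in
/-- The point with coordinates `s` of the solid unit cube spanned by the cube `c` of `G`, recorded
by its multilinear barycentric weights on the vertices: the vertex `c ε` has weight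
`∏ i, (s i or 1 - s i)`, according to `ε i`, and vertices outside the cube have weight `0`. Points
of different solid cubes get the same weights exactly when they are the same point of a
common face. -/
noncomputable def cubePoint {G : SimpleGraph V} {n : ℕ} (c : hypercubeGraph n ↪g G)
    (s : Fin n → Set.Icc (0 : ℝ) 1) : V → ℝ := fun v =>
  ∑ ε : Fin n → Bool, if c ε = v then ∏ i, (if ε i then (s i : ℝ) else 1 - (s i : ℝ)) else 0

/-- The points of the geometric realization `|G|`, in which every (induced) cube of `G`, of any
dimension, is replaced by a solid unit cube. -/
def Realization (G : SimpleGraph V) : Type u :=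
  {w : V → ℝ // ∃ (n : ℕ) (c : hypercubeGraph n ↪g G) (s : Fin n → Set.Icc (0 : ℝ) 1),
    w = cubePoint c s}

/-- The solid unit cube of `|G|` spanned by the cube `c` of `G`. -/
noncomputable def solidCube {G : SimpleGraph V} {n : ℕ} (c : hypercubeGraph n ↪g G) :
    BoxCell (Realization G) where
  dim := n
  side := fun _ => 1
  side_pos := fun _ => one_pos
  chart := fun s => ⟨cubePoint c s, n, c, s, rfl⟩

/-- The cells of the cube complex `|G|`. -/
def realizationCells (G : SimpleGraph V) : Set (BoxCell (Realization G)) :=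
  {C | ∃ (n : ℕ) (c : hypercubeGraph n ↪g G), C = solidCube c}

lemma abs_prod_sub_prod_le {ι : Type*} (S : Finset ι) (a b : ι → ℝ)
    (ha : ∀ i, |a i| ≤ 1) (hb : ∀ i, |b i| ≤ 1) :
    |∏ i ∈ S, a i - ∏ i ∈ S, b i| ≤ ∑ i ∈ S, |a i - b i| := by
  classical
  induction S using Finset.induction_on with
  | empty => simp
  | insert j S hj ih =>
    rw [Finset.prod_insert hj, Finset.prod_insert hj, Finset.sum_insert hj]
    have h1 : |∏ i ∈ S, a i| ≤ 1 := by
      rw [Finset.abs_prod]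
      exact Finset.prod_le_one (fun i _ => abs_nonneg _) fun i _ => ha i
    have e : a j * ∏ i ∈ S, a i - b j * ∏ i ∈ S, b i =
        (a j - b j) * ∏ i ∈ S, a i + b j * (∏ i ∈ S, a i - ∏ i ∈ S, b i) := by ring
    rw [e]
    refine (abs_add_le _ _).trans (add_le_add ?_ ?_)
    · rw [abs_mul]
      exact mul_le_of_le_one_right (abs_nonneg _) h1
    · rw [abs_mul]
      exact (mul_le_of_le_one_left (abs_nonneg _) (hb j)).trans ih

lemma abs_cubePoint_sub_le {G : SimpleGraph V} {n : ℕ} (c : hypercubeGraph n ↪g G)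
    (s t : Fin n → Set.Icc (0 : ℝ) 1) (v : V) :
    |cubePoint c s v - cubePoint c t v| ≤ ∑ i, |(s i : ℝ) - (t i : ℝ)| := by
  classical
  by_cases h : ∃ ε, c ε = v
  · obtain ⟨ε, rfl⟩ := h
    have key : ∀ r : Fin n → Set.Icc (0 : ℝ) 1,
        cubePoint c r (c ε) = ∏ i, (if ε i then (r i : ℝ) else 1 - (r i : ℝ)) := by
      intro r
      unfold cubePoint
      rw [Finset.sum_eq_single ε]
      · simp
      · intro δ _ hδ
        rw [if_neg fun h => hδ (c.injective h)]
      · simp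
    have bound : ∀ (r : Fin n → Set.Icc (0 : ℝ) 1) (i : Fin n),
        |(if ε i then (r i : ℝ) else 1 - (r i : ℝ))| ≤ 1 := by
      intro r i
      have h0 := (r i).2.1
      have h1 := (r i).2.2
      split_ifs <;> rw [abs_le] <;> constructor <;> linarith
    rw [key, key]
    refine (abs_prod_sub_prod_le _ _ _ (bound s) (bound t)).trans
      (Finset.sum_le_sum fun i _ => ?_)
    split_ifs
    · exact le_rfl
    · rw [abs_sub_comm (s i : ℝ)]
      exact le_of_eq (by congr 1; ring)
  · have key : ∀ r : Fin n → Set.Icc (0 : ℝ) 1, cubePoint c r v = 0 := by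
      intro r
      unfold cubePoint
      exact Finset.sum_eq_zero fun ε _ => if_neg fun hε => h ⟨ε, hε⟩
    rw [key, key, sub_self, abs_zero]
    exact Finset.sum_nonneg fun i _ => abs_nonneg _

lemma edist_weight_le_localEDist {G : SimpleGraph V} (x y : Realization G) (v : V) :
    edist (x.1 v) (y.1 v) ≤ ⨅ C ∈ realizationCells G, C.localEDist x y := by
  refine le_iInf₂ fun C hC => ?_
  obtain ⟨n, c, rfl⟩ := hC
  refine le_iInf fun s => le_iInf fun t => le_iInf fun hs => le_iInf fun ht => ?_
  subst hs ht
  change edist (cubePoint c s v) (cubePoint c t v) ≤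
    ∑ i : Fin n, edist (s i : ℝ) (t i : ℝ)
  simp only [edist_dist, Real.dist_eq]
  rw [← ENNReal.ofReal_sum_of_nonneg fun i _ => abs_nonneg _]
  exact ENNReal.ofReal_le_ofReal (abs_cubePoint_sub_le c s t v)

lemma edist_weight_le_intrinsicEDist {G : SimpleGraph V} (x y : Realization G) (v : V) :
    edist (x.1 v) (y.1 v) ≤ intrinsicEDist (realizationCells G) x y := by
  refine le_iInf fun n => le_iInf fun p => le_iInf fun h0 => le_iInf fun hn => ?_
  subst h0 hn
  exact (edist_le_range_sum_edist (fun i => (p i).1 v) n).trans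
    (Finset.sum_le_sum fun i _ => edist_weight_le_localEDist _ _ v)

/-- The geometric realization `|G|` carries the intrinsic `l₁`-metric. -/
noncomputable instance (G : SimpleGraph V) : EMetricSpace (Realization G) where
  edist := intrinsicEDist (realizationCells G)
  edist_self := intrinsicEDist_self _
  edist_comm := intrinsicEDist_comm _
  edist_triangle := intrinsicEDist_triangle _
  eq_of_edist_eq_zero := fun {x y} h => Subtype.ext <| funext fun v =>
    edist_eq_zero.1 <| le_antisymm ((edist_weight_le_intrinsicEDist x y v).trans h.le) bot_le

end realization

/-!
The proof replaces the geometric realization by explicit coordinates and finds everything else by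
inspection of small cliques.

**The group.** Every group `Γ` is the automorphism group of a bipartite graph `F`
(`exists_bipartite_graph_aut`), which is finite for finite `Γ`. The graph encodes the arrows
`x ⟶ x * g` of the Cayley graph of `Γ`. The colours `g` are kept apart by a well-order on the set of
colours: a well-order has no automorphisms, and it is recorded in the graph by the inclusions among
the neighbourhoods of auxiliary vertices. An automorphism fixes the only leaf, hence preserves the
types of vertices step by step, fixes the colours, and therefore acts as a left multiplication.

**The combinatorics of `κ(H)`.** The distance of two cliques in `κ(H)` is the cardinality of their
symmetric difference (`simplexGraph_dist`). Let `H` be bipartite with three pairwise disjoint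
edges. No clique of `H` meets all three edges, so the empty clique is the only vertex of `κ(H)` of
eccentricity at most `2`. This gives the radius, and, since automorphisms then fix the empty
clique, it gives `Aut(κ(H)) ≅ Aut(H)` (`simplexGraphAutEquiv`). Splitting a clique into its two
colour classes embeds `κ(H)` isometrically into the product of two stars. Since `κ(F)` is again
bipartite with three disjoint edges, these facts apply both to `H = F` and to `H = κ(F)`.

**The realization of `κ(H)`.** A point is a function `W → [0, 1]` whose support is a clique of `H`,
and the intrinsic metric is the `l₁`-metric (`CliqueSpace.isometryEquivRealization`): a chain
cannot be shorter than the `l₁`-distance, and this distance is attained by the chain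
`x, min x y, y`, both steps of which stay in one cube. The cubes of `κ(H)` are the intervals
`{s | A ⊆ s ⊆ B}` of cliques (`exists_isFrame`, `exists_cube`), and their solid cubes are the sets
of functions that are `1` on `A` and `0` off `B`; intersections and faces are again of this form.
Restriction to the
two colour classes of `H` embeds the realization into the product of two stars with arms of length
`1`, which are finite dendrons (`StarSpace.isFiniteDendron`).

**Isometries.** The function `0` is the only point with distance at most `2` from all points. If
every vertex of `H` has two neighbours, the indicator function of `{a}` is recognized as a point at
distance `1` from `0` and at distance `1` from two different points at distance `2` from `0`.
Finally a point is determined by its distances from these points, so that every isometry is induced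
by an automorphism of `H` (`CliqueSpace.isometryAction_bijective`).

**Connectivity.** If `H` is connected, deleting the centre of `κ(H)`, or of its realization, leaves
a connected set, because every other point can be moved away from the centre and then along the
edges of `H`. Deleting any other point leaves all points connected to the centre.
-/

/-! ### Distances in simplex graphs -/

section SimplexGraphDist

open scoped Classical symmDiff

variable {W : Type u} {H : SimpleGraph W}

/-- The finite cliques of `H`, that is, the vertices of the simplex graph `κ(H)`. -/
abbrev FiniteClique (H : SimpleGraph W) : Type u := {s : Finset W // H.IsClique (s : Set W)}

namespace FiniteClique

/-- The empty clique. -/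
def empty (H : SimpleGraph W) : FiniteClique H := ⟨∅, by simp⟩

/-- The clique consisting of one vertex. -/
def single (H : SimpleGraph W) (a : W) : FiniteClique H := ⟨{a}, by simp⟩

/-- The clique consisting of the two ends of an edge. -/
noncomputable def pair {a b : W} (h : H.Adj a b) : FiniteClique H :=
  ⟨{a, b}, by simpa [SimpleGraph.isClique_pair] using fun _ => h⟩

/-- A subset of a clique, as a clique. -/
def ofSubset (s : FiniteClique H) (t : Finset W) (h : t ⊆ s.1) : FiniteClique H :=
  ⟨t, s.2.subset (Finset.coe_subset.2 h)⟩

@[simp] lemma coe_empty : (empty H).1 = ∅ := rfl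
@[simp] lemma coe_single (a : W) : (single H a).1 = {a} := rfl
@[simp] lemma coe_pair {a b : W} (h : H.Adj a b) : (pair h).1 = {a, b} := rfl
@[simp] lemma coe_ofSubset (s : FiniteClique H) (t : Finset W) (h : t ⊆ s.1) :
    (ofSubset s t h).1 = t := rfl

lemma single_injective : Function.Injective (single H) := fun a b h => by
  simpa using congrArg Subtype.val h

end FiniteClique

open FiniteClique

lemma simplexGraph_adj {s t : FiniteClique H} :
    (simplexGraph H).Adj s t ↔ (s.1 ∆ t.1).card = 1 := by
  simp only [simplexGraph, Finset.card_eq_one]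
  refine exists_congr fun v => ?_
  rw [← Finset.coe_symmDiff, ← Finset.coe_singleton, Finset.coe_inj]

lemma empty_symmDiff_finset (s : Finset W) : ∅ ∆ s = s := bot_symmDiff s

lemma symmDiff_empty_finset (s : Finset W) : s ∆ ∅ = s := symmDiff_bot s

lemma card_symmDiff_triangle (s t r : Finset W) :
    (s ∆ r).card ≤ (s ∆ t).card + (t ∆ r).card :=
  (Finset.card_le_card (symmDiff_triangle s t r)).trans (Finset.card_union_le _ _)

lemma card_symmDiff_le_length {s t : FiniteClique H} (p : (simplexGraph H).Walk s t) :
    (s.1 ∆ t.1).card ≤ p.length := by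
  induction p with
  | nil => simp
  | @cons s r t h p ih =>
    have h1 := card_symmDiff_triangle s.1 r.1 t.1
    rw [simplexGraph_adj.1 h] at h1
    rw [SimpleGraph.Walk.length_cons]
    omega

/-- Two cliques are joined by the walk that first deletes and then adds vertices. -/
lemma exists_walk_length_eq_card_symmDiff (n : ℕ) (s t : FiniteClique H)
    (h : (s.1 ∆ t.1).card = n) : ∃ p : (simplexGraph H).Walk s t, p.length = n := by
  induction n generalizing s with
  | zero =>
    rw [Finset.card_eq_zero] at h
    obtain rfl : s = t := Subtype.ext (symmDiff_eq_bot.1 h)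
    exact ⟨.nil, rfl⟩
  | succ n ih =>
    have key : ∀ (r : FiniteClique H) (v : W), v ∈ s.1 ∆ t.1 → s.1 ∆ r.1 = {v} →
        ∃ p : (simplexGraph H).Walk s t, p.length = n + 1 := by
      intro r v hv hr
      have e : r.1 ∆ t.1 = (s.1 ∆ t.1).erase v := by
        have : r.1 ∆ t.1 = (s.1 ∆ r.1) ∆ (s.1 ∆ t.1) := by
          rw [symmDiff_comm s.1 r.1, symmDiff_assoc, symmDiff_symmDiff_cancel_left]
        rw [this, hr]
        ext x
        simp only [Finset.mem_symmDiff, Finset.mem_singleton, Finset.mem_erase] at hv ⊢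
        grind
      obtain ⟨p, hp⟩ := ih r (by rw [e, Finset.card_erase_of_mem hv, h]; rfl)
      exact ⟨.cons (simplexGraph_adj.2 (by rw [hr]; rfl)) p, by simp [hp]⟩
    by_cases hs : s.1 ⊆ t.1
    · obtain ⟨v, hv⟩ : (s.1 ∆ t.1).Nonempty := Finset.card_pos.1 (by omega)
      have hv' : v ∈ t.1 ∧ v ∉ s.1 := by
        rcases Finset.mem_symmDiff.1 hv with h | h
        · exact absurd (hs h.1) h.2
        · exact h
      refine key (ofSubset t (insert v s.1) (Finset.insert_subset hv'.1 hs)) v hv ?_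
      ext x
      simp only [coe_ofSubset, Finset.mem_symmDiff, Finset.mem_insert, Finset.mem_singleton]
      grind
    · obtain ⟨v, hv, hv'⟩ := Finset.not_subset.1 hs
      refine key (ofSubset s (s.1.erase v) (Finset.erase_subset _ _)) v
        (Finset.mem_symmDiff.2 (Or.inl ⟨hv, hv'⟩)) ?_
      ext x
      simp only [coe_ofSubset, Finset.mem_symmDiff, Finset.mem_erase, Finset.mem_singleton]
      grind

lemma simplexGraph_connected (H : SimpleGraph W) : (simplexGraph H).Connected where
  preconnected s t := (exists_walk_length_eq_card_symmDiff _ s t rfl).nonempty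
  nonempty := ⟨empty H⟩

lemma simplexGraph_dist (s t : FiniteClique H) :
    (simplexGraph H).dist s t = (s.1 ∆ t.1).card := by
  refine le_antisymm ?_ ?_
  · obtain ⟨p, hp⟩ := exists_walk_length_eq_card_symmDiff _ s t rfl
    exact hp ▸ SimpleGraph.dist_le p
  · obtain ⟨p, hp⟩ := (simplexGraph_connected H).exists_walk_length_eq_dist s t
    exact hp ▸ card_symmDiff_le_length p

/-- Simplex graphs are bipartite: the cardinality of adjacent cliques differs by one. -/
def simplexGraphColoring (H : SimpleGraph W) : (simplexGraph H).Coloring Bool :=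
  SimpleGraph.Coloring.mk (fun s => decide (Even s.1.card)) fun {s t} h => by
    have h1 := simplexGraph_adj.1 h
    have h2 : (s.1 ∆ t.1).card + 2 * (s.1 ∩ t.1).card = s.1.card + t.1.card := by
      have a := Finset.card_sdiff_add_card_inter s.1 t.1
      have b := Finset.card_sdiff_add_card_inter t.1 s.1
      have c : (s.1 ∆ t.1).card = (s.1 \ t.1).card + (t.1 \ s.1).card :=
        Finset.card_union_of_disjoint disjoint_sdiff_sdiff
      rw [Finset.inter_comm t.1] at b
      omega
    intro h3
    rw [decide_eq_decide, Nat.even_iff, Nat.even_iff] at h3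
    omega

end SimplexGraphDist

/-! ### Bipartite graphs with three disjoint edges -/

section BipartiteSimplexGraph

open scoped Classical symmDiff

open FiniteClique

variable {W : Type u} {H : SimpleGraph W}

/-- `H` contains three pairwise disjoint edges. -/
def HasThreeDisjointEdges (H : SimpleGraph W) : Prop :=
  ∃ a b : Fin 3 → W, (∀ i, H.Adj (a i) (b i)) ∧
    ∀ i j, i ≠ j → a i ≠ a j ∧ a i ≠ b j ∧ b i ≠ b j

lemma FiniteClique.eq_of_coloring_eq (χ : H.Coloring Bool) (s : FiniteClique H) {a b : W}
    (ha : a ∈ s.1) (hb : b ∈ s.1) (h : χ a = χ b) : a = b := by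
  by_contra hab
  exact χ.valid (s.2 ha hb hab) h

lemma FiniteClique.card_le_two (χ : H.Coloring Bool) (s : FiniteClique H) : s.1.card ≤ 2 := by
  have := Finset.card_le_card_of_injOn (s := s.1) (t := Finset.univ) χ
    (fun _ _ => Finset.mem_coe.2 (Finset.mem_univ _))
    fun a ha b hb h => s.eq_of_coloring_eq χ ha hb h
  simpa using this

/-- A clique of a bipartite graph cannot meet each of three disjoint edges. -/
lemma FiniteClique.exists_disjoint_edge (χ : H.Coloring Bool) (h3 : HasThreeDisjointEdges H)
    (s : FiniteClique H) : ∃ a b, H.Adj a b ∧ a ∉ s.1 ∧ b ∉ s.1 := by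
  obtain ⟨a, b, hab, hd⟩ := h3
  by_contra! hcon
  have : ∀ i, ∃ c ∈ s.1, c = a i ∨ c = b i := by
    intro i
    by_cases hi : a i ∈ s.1
    · exact ⟨_, hi, Or.inl rfl⟩
    · exact ⟨_, hcon _ _ (hab i) hi, Or.inr rfl⟩
  choose c hc hc' using this
  have hinj : Function.Injective c := by
    intro i j hij
    by_contra hne
    obtain ⟨h1, h2, h3⟩ := hd i j hne
    obtain ⟨-, h4, -⟩ := hd j i (Ne.symm hne)
    rcases hc' i with h | h <;> rcases hc' j with h' | h' <;> grind
  have := Finset.card_le_card_of_injOn (s := Finset.univ) (t := s.1) c (by simpa using hc)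
    hinj.injOn
  have h2 := s.card_le_two χ
  simp at this
  omega

lemma HasThreeDisjointEdges.simplexGraph (h : HasThreeDisjointEdges H) :
    HasThreeDisjointEdges (simplexGraph H) := by
  obtain ⟨a, b, hab, hd⟩ := h
  refine ⟨fun i => single H (a i), fun i => pair (hab i), fun i => ?_, fun i j hij => ⟨?_, ?_, ?_⟩⟩
  · rw [simplexGraph_adj, Finset.card_eq_one]
    refine ⟨b i, ?_⟩
    ext x
    have := (hab i).ne
    simp only [coe_single, coe_pair, Finset.mem_symmDiff, Finset.mem_singleton, Finset.mem_insert]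
    grind
  · exact fun h => (hd i j hij).1 (single_injective h)
  · intro h
    have := congrArg (fun s : FiniteClique H => b j ∈ s.1) h
    simp at this
    exact (hd j i hij.symm).2.1 (by have := (hd i j hij).2.1; grind)
  · intro h
    have := congrArg (fun s : FiniteClique H => a i ∈ s.1) h
    have h1 := hd i j hij
    simp at this
    grind

/-- If every vertex of `F` has a neighbour and `F` has two vertices, then every vertex of `κ(F)`
has two neighbours. -/
lemma simplexGraph_exists_two_neighbors (hne : ∃ a b : W, a ≠ b)
    (hn : ∀ a, ∃ b, H.Adj a b) (s : FiniteClique H) :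
    ∃ t r, t ≠ r ∧ (simplexGraph H).Adj s t ∧ (simplexGraph H).Adj s r := by
  have herase : ∀ a ∈ s.1,
      (simplexGraph H).Adj s (ofSubset s (s.1.erase a) (Finset.erase_subset _ _)) := by
    intro a ha
    rw [simplexGraph_adj, Finset.card_eq_one]
    refine ⟨a, ?_⟩
    ext x
    simp only [coe_ofSubset, Finset.mem_symmDiff, Finset.mem_erase, Finset.mem_singleton]
    grind
  rcases Nat.lt_or_ge 1 s.1.card with hs | hs
  · obtain ⟨a, ha, b, hb, hab⟩ := Finset.one_lt_card.1 hs
    refine ⟨_, _, ?_, herase a ha, herase b hb⟩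
    intro h
    have := congrArg (fun s : FiniteClique H => a ∈ s.1) h
    simp [ha, hab] at this
  · rcases Nat.lt_or_ge 0 s.1.card with hs' | hs'
    · obtain ⟨a, ha⟩ := Finset.card_eq_one.1 (le_antisymm hs hs')
      obtain ⟨b, hb⟩ := hn a
      refine ⟨_, pair hb, ?_, herase a (by simp [ha]), ?_⟩
      · intro h
        have := congrArg (fun s : FiniteClique H => a ∈ s.1) h
        simp at this
      · rw [simplexGraph_adj, Finset.card_eq_one]
        refine ⟨b, ?_⟩
        ext x
        have := hb.ne
        simp only [ha, coe_pair, Finset.mem_symmDiff, Finset.mem_insert, Finset.mem_singleton]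
        grind
    · have hs0 : s.1 = ∅ := Finset.card_eq_zero.1 (by omega)
      obtain ⟨a, b, hab⟩ := hne
      refine ⟨single H a, single H b, fun h => hab (single_injective h), ?_, ?_⟩ <;>
      simp [simplexGraph_adj, hs0, empty_symmDiff_finset]

/-- The empty clique is the only vertex of eccentricity at most `2` of `κ(H)`. -/
lemma exists_two_lt_card_symmDiff (χ : H.Coloring Bool) (h3 : HasThreeDisjointEdges H)
    (s : FiniteClique H) : ∃ t : FiniteClique H, (s.1 ∆ t.1).card = s.1.card + 2 := by
  obtain ⟨a, b, hab, ha, hb⟩ := s.exists_disjoint_edge χ h3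
  refine ⟨pair hab, ?_⟩
  have : Disjoint s.1 (pair hab).1 := by
    rw [Finset.disjoint_left]
    intro x hx
    simp only [coe_pair, Finset.mem_insert, Finset.mem_singleton]
    grind
  rw [this.symmDiff_eq_sup, Finset.sup_eq_union, Finset.card_union_of_disjoint this, coe_pair,
    Finset.card_pair hab.ne]

lemma simplexGraph_edist (s t : FiniteClique H) :
    (simplexGraph H).edist s t = (s.1 ∆ t.1).card := by
  rw [← simplexGraph_dist, ((simplexGraph_connected H).preconnected s t).coe_dist_eq_edist]

lemma simplexGraph_radius (χ : H.Coloring Bool) (h3 : HasThreeDisjointEdges H) :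
    (simplexGraph H).radius = 2 := by
  refine le_antisymm ((SimpleGraph.radius_le_eccent (u := empty H)).trans ?_) ?_
  · rw [SimpleGraph.eccent_le_iff]
    intro t
    rw [simplexGraph_edist]
    have := t.card_le_two χ
    rw [coe_empty, empty_symmDiff_finset]
    exact_mod_cast this
  · refine le_iInf fun s => ?_
    obtain ⟨t, ht⟩ := exists_two_lt_card_symmDiff χ h3 s
    refine le_trans ?_ (SimpleGraph.edist_le_eccent (v := t))
    rw [simplexGraph_edist, ht]
    exact_mod_cast Nat.le_add_left 2 _

/-! ### Tree embeddings and connectivity -/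

/-- The simplex graph of an edgeless graph is a star centred at the empty clique. -/
lemma simplexGraph_bot_isTree (W : Type u) : (simplexGraph (⊥ : SimpleGraph W)).IsTree := by
  have hcard : ∀ s : FiniteClique (⊥ : SimpleGraph W), s.1.card ≤ 1 := fun s =>
    Finset.card_le_one.2 fun a ha b hb => by
      by_contra hab
      exact s.2 ha hb hab
  have : simplexGraph (⊥ : SimpleGraph W) = SimpleGraph.starGraph (empty ⊥) := by
    ext s t
    rw [SimpleGraph.starGraph_adj, simplexGraph_adj]
    constructor
    · intro h
      have hne : s ≠ t := by rintro rfl; simp at h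
      refine ⟨hne, ?_⟩
      by_contra! hcon
      have hs : ∀ s : FiniteClique (⊥ : SimpleGraph W), s ≠ empty ⊥ → ∃ a, s.1 = {a} := by
        intro s hs
        refine Finset.card_eq_one.1 (le_antisymm (hcard s) (Finset.card_pos.2 ?_))
        rw [Finset.nonempty_iff_ne_empty]
        exact fun h => hs (Subtype.ext h)
      obtain ⟨a, ha⟩ := hs s hcon.1
      obtain ⟨b, hb⟩ := hs t hcon.2
      have hab : a ≠ b := by
        rintro rfl
        exact hne (Subtype.ext (ha.trans hb.symm))
      have hd : Disjoint ({a} : Finset W) {b} := by simpa using hab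
      rw [ha, hb, hd.symmDiff_eq_sup, Finset.sup_eq_union, Finset.card_union_of_disjoint hd] at h
      simp at h
    · rintro ⟨hne, rfl | rfl⟩
      · refine le_antisymm (by simpa [empty_symmDiff_finset] using hcard t) (Finset.card_pos.2 ?_)
        rw [Finset.nonempty_iff_ne_empty]
        exact fun h => hne (Subtype.ext (symmDiff_eq_bot.1 h))
      · refine le_antisymm (by simpa [symmDiff_empty_finset] using hcard s) (Finset.card_pos.2 ?_)
        rw [Finset.nonempty_iff_ne_empty]
        exact fun h => hne (Subtype.ext (symmDiff_eq_bot.1 h))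
  rw [this]
  exact SimpleGraph.isTree_starGraph _

/-- The part of a clique that has a given colour. It has at most one element. -/
noncomputable def FiniteClique.colorPart (χ : H.Coloring Bool) (i : Bool) (s : FiniteClique H) :
    FiniteClique (⊥ : SimpleGraph W) :=
  ⟨s.1.filter (χ · = i), fun a ha b hb hab => by
    simp only [Finset.coe_filter, Set.mem_ofPred_eq] at ha hb
    exact absurd (s.eq_of_coloring_eq χ ha.1 hb.1 (ha.2.trans hb.2.symm)) hab⟩

lemma simplexGraph_isPartialDoubleTree (χ : H.Coloring Bool) :
    IsPartialDoubleTree (simplexGraph H) := by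
  refine ⟨simplexGraph_connected H, _, _, simplexGraph (⊥ : SimpleGraph W), simplexGraph ⊥,
    simplexGraph_bot_isTree W, simplexGraph_bot_isTree W,
    fun s => (colorPart χ true s, colorPart χ false s), fun s t => ?_⟩
  have h : ((simplexGraph (⊥ : SimpleGraph W)).boxProd (simplexGraph ⊥)).edist
      (colorPart χ true s, colorPart χ false s) (colorPart χ true t, colorPart χ false t) =
      (simplexGraph H).edist s t := by
    rw [SimpleGraph.edist_boxProd, simplexGraph_edist, simplexGraph_edist, simplexGraph_edist]
    rw [← Finset.card_filter_add_card_filter_not (s := s.1 ∆ t.1) (χ · = true)]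
    push_cast
    congr 3
    · ext x
      simp only [colorPart, Finset.mem_symmDiff, Finset.mem_filter]
      grind
    · ext x
      simp only [colorPart, Finset.mem_symmDiff, Finset.mem_filter]
      grind
  exact congrArg ENat.toNat h

/-- Deleting the empty clique leaves a subdivision of `H`; every other deleted vertex leaves all
cliques connected to the empty one. -/
lemma simplexGraph_isTwoConnected (χ : H.Coloring Bool) (h3 : HasThreeDisjointEdges H)
    (hH : H.Connected) : IsTwoConnected (simplexGraph H) := by
  refine ⟨simplexGraph_connected H, ?_, fun v => ?_⟩
  · obtain ⟨a, b, -, hd⟩ := h3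
    have hinj : Function.Injective a := fun i j h => by
      by_contra hij
      exact (hd i j hij).1 h
    have := ENat.card_le_card_of_injective (single_injective (H := H).comp hinj)
    simpa using this
  have hadj : ∀ {s t : FiniteClique H} (_ : (s.1 ∆ t.1).card = 1) (hs : s ≠ v) (ht : t ≠ v),
      ((simplexGraph H).induce {v}ᶜ).Reachable ⟨s, hs⟩ ⟨t, ht⟩ := fun {s t} h hs ht =>
    SimpleGraph.Adj.reachable (by simpa using simplexGraph_adj.2 h)
  have hpair : ∀ {a b : W} (h : H.Adj a b),
      (({a} : Finset W) ∆ {a, b}).card = 1 := fun {a b} h => by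
    rw [Finset.card_eq_one]
    refine ⟨b, ?_⟩
    ext x
    have := h.ne
    simp only [Finset.mem_symmDiff, Finset.mem_singleton, Finset.mem_insert]
    grind
  have hcomm : ∀ {a b : W} (h : H.Adj a b), pair h = pair h.symm := fun h =>
    Subtype.ext (Finset.pair_comm _ _)
  -- Every clique is empty, a single vertex, or an edge.
  have hcases : ∀ s : FiniteClique H,
      s = empty H ∨ (∃ a, s = single H a) ∨ ∃ (a b : W) (h : H.Adj a b), s = pair h := by
    intro s
    have := s.card_le_two χ
    interval_cases h : s.1.card
    · exact Or.inl (Subtype.ext (Finset.card_eq_zero.1 h))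
    · obtain ⟨a, ha⟩ := Finset.card_eq_one.1 h
      exact Or.inr (Or.inl ⟨a, Subtype.ext ha⟩)
    · obtain ⟨a, b, hab, hs⟩ := Finset.card_eq_two.1 h
      exact Or.inr (Or.inr ⟨a, b, s.2 (by simp [hs]) (by simp [hs]) hab, Subtype.ext hs⟩)
  by_cases hv : v = empty H
  · have hs : ∀ a, single H a ≠ v := fun a h => by
      have := congrArg Subtype.val (h.trans hv)
      simp at this
    have hp : ∀ {a b} (h : H.Adj a b), pair h ≠ v := fun h h' => by
      have := congrArg Subtype.val (h'.trans hv)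
      simp at this
    have hss : ∀ a b, ((simplexGraph H).induce {v}ᶜ).Reachable
        ⟨single H a, hs a⟩ ⟨single H b, hs b⟩ := by
      intro a b
      obtain ⟨p⟩ := hH.preconnected a b
      induction p with
      | nil => exact .refl _
      | @cons a b c h p ih =>
        refine SimpleGraph.Reachable.trans ?_ ih
        refine (hadj (by simpa using hpair h) (hs a) (hp h)).trans ?_
        refine hadj ?_ _ _
        rw [symmDiff_comm, hcomm h]
        exact hpair h.symm
    have hall : ∀ s (h : s ≠ v), ∃ a, ((simplexGraph H).induce {v}ᶜ).Reachable
        ⟨s, h⟩ ⟨single H a, hs a⟩ := by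
      intro s h
      rcases hcases s with rfl | ⟨a, rfl⟩ | ⟨a, b, hab, rfl⟩
      · exact absurd hv.symm h
      · exact ⟨a, .refl _⟩
      · exact ⟨a, hadj (by rw [symmDiff_comm]; exact hpair hab) _ _⟩
    obtain ⟨a⟩ := hH.nonempty
    exact
      { preconnected := fun s t => by
          obtain ⟨a, ha⟩ := hall s.1 s.2
          obtain ⟨b, hb⟩ := hall t.1 t.2
          exact (ha.trans (hss a b)).trans hb.symm
        nonempty := ⟨⟨_, hs a⟩⟩ }
  · have hs : ∀ a (h : single H a ≠ v), ((simplexGraph H).induce {v}ᶜ).Reachable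
        ⟨single H a, h⟩ ⟨empty H, Ne.symm hv⟩ := fun a h =>
      hadj (by simp [symmDiff_empty_finset]) _ _
    have hall : ∀ s (h : s ≠ v), ((simplexGraph H).induce {v}ᶜ).Reachable
        ⟨s, h⟩ ⟨empty H, Ne.symm hv⟩ := by
      intro s h
      rcases hcases s with rfl | ⟨a, rfl⟩ | ⟨a, b, hab, rfl⟩
      · exact .refl _
      · exact hs a h
      · by_cases ha : single H a = v
        · have hb : single H b ≠ v := fun hb => hab.ne (single_injective (ha.trans hb.symm))
          refine (hadj ?_ _ hb).trans (hs b hb)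
          rw [symmDiff_comm, hcomm hab]
          exact hpair hab.symm
        · exact (hadj (by rw [symmDiff_comm]; exact hpair hab) _ ha).trans (hs a ha)
    exact
      { preconnected := fun s t => (hall s.1 s.2).trans (hall t.1 t.2).symm
        nonempty := ⟨⟨_, Ne.symm hv⟩⟩ }

end BipartiteSimplexGraph

/-! ### Automorphisms of simplex graphs -/

section SimplexGraphAut

open scoped Classical symmDiff

open FiniteClique

variable {W : Type u} {H : SimpleGraph W}

/-- The image of a clique under a graph automorphism. -/
def FiniteClique.map (σ : H ≃g H) (s : FiniteClique H) : FiniteClique H :=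
  ⟨s.1.map σ.toEquiv.toEmbedding, by
    intro a ha b hb hab
    simp only [Finset.coe_map, Equiv.coe_toEmbedding, Set.mem_image, Finset.mem_coe] at ha hb
    obtain ⟨a, ha, rfl⟩ := ha
    obtain ⟨b, hb, rfl⟩ := hb
    exact σ.map_rel_iff.2 (s.2 ha hb fun h => hab (congrArg _ h))⟩

lemma FiniteClique.mem_map {σ : H ≃g H} {s : FiniteClique H} {a : W} :
    a ∈ (s.map σ).1 ↔ σ.symm a ∈ s.1 := by
  simp only [FiniteClique.map, Finset.mem_map_equiv]
  rfl

/-- The action of the automorphisms of `H` on the simplex graph of `H`. -/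
def simplexGraphAut (H : SimpleGraph W) : (H ≃g H) →* (simplexGraph H ≃g simplexGraph H) where
  toFun σ :=
    { toFun := FiniteClique.map σ
      invFun := FiniteClique.map σ.symm
      left_inv := fun s => by
        refine Subtype.ext (Finset.ext fun a => ?_)
        simp [FiniteClique.mem_map]
      right_inv := fun s => by
        refine Subtype.ext (Finset.ext fun a => ?_)
        simp [FiniteClique.mem_map]
      map_rel_iff' := fun {s t} => by
        rw [simplexGraph_adj, simplexGraph_adj]
        simp only [FiniteClique.map, Equiv.coe_fn_mk, Finset.map_eq_image]
        rw [← Finset.image_symmDiff _ _ σ.toEquiv.toEmbedding.injective,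
          Finset.card_image_of_injective _ σ.toEquiv.toEmbedding.injective] }
  map_one' := by
    ext s : 1
    refine Subtype.ext (Finset.ext fun a => ?_)
    change a ∈ (FiniteClique.map 1 s).1 ↔ a ∈ s.1
    rw [FiniteClique.mem_map]
    rfl
  map_mul' σ τ := by
    ext s : 1
    refine Subtype.ext (Finset.ext fun a => ?_)
    change a ∈ (FiniteClique.map (σ * τ) s).1 ↔ a ∈ (FiniteClique.map σ (FiniteClique.map τ s)).1
    simp only [FiniteClique.mem_map]
    rfl

lemma simplexGraphAut_apply (σ : H ≃g H) (s : FiniteClique H) :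
    simplexGraphAut H σ s = s.map σ := rfl

lemma card_symmDiff_aut (φ : simplexGraph H ≃g simplexGraph H) (s t : FiniteClique H) :
    ((φ s).1 ∆ (φ t).1).card = (s.1 ∆ t.1).card := by
  have key : ∀ (φ : simplexGraph H ≃g simplexGraph H) (s t : FiniteClique H),
      ((φ s).1 ∆ (φ t).1).card ≤ (s.1 ∆ t.1).card := by
    intro φ s t
    obtain ⟨p, hp⟩ := exists_walk_length_eq_card_symmDiff _ s t rfl
    rw [← hp, ← SimpleGraph.Walk.length_map φ.toHom p]
    exact card_symmDiff_le_length _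
  refine le_antisymm (key φ s t) ?_
  simpa using key φ.symm (φ s) (φ t)

/-- An automorphism of `κ(H)` fixes the empty clique, hence permutes the one-vertex cliques, and
an edge is determined by the position of its clique relative to its ends. -/
lemma simplexGraphAut_bijective (χ : H.Coloring Bool) (h3 : HasThreeDisjointEdges H) :
    Function.Bijective (simplexGraphAut H) := by
  constructor
  · intro σ τ h
    ext a
    have := DFunLike.congr_fun h (single H a)
    simp only [simplexGraphAut_apply] at this
    have h2 : σ a ∈ (FiniteClique.map τ (single H a)).1 := by
      rw [← this, FiniteClique.mem_map]
      simp
    rw [FiniteClique.mem_map] at h2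
    simp only [coe_single, Finset.mem_singleton] at h2
    exact (RelIso.symm_apply_eq τ).1 h2
  · intro φ
    have hempty : ∀ φ : simplexGraph H ≃g simplexGraph H, φ (empty H) = empty H := by
      intro φ
      obtain ⟨t, ht⟩ := exists_two_lt_card_symmDiff χ h3 (φ (empty H))
      have h1 := card_symmDiff_aut φ (empty H) (φ.symm t)
      rw [RelIso.apply_symm_apply, ht, coe_empty, empty_symmDiff_finset] at h1
      have := FiniteClique.card_le_two χ (φ.symm t)
      exact Subtype.ext (Finset.card_eq_zero.1 (by omega))
    have hcard : ∀ (φ : simplexGraph H ≃g simplexGraph H) (s : FiniteClique H),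
        (φ s).1.card = s.1.card := by
      intro φ s
      have := card_symmDiff_aut φ (empty H) s
      rwa [hempty, coe_empty, empty_symmDiff_finset, empty_symmDiff_finset] at this
    have hsingle : ∀ (φ : simplexGraph H ≃g simplexGraph H) (a : W),
        ∃ b, φ (single H a) = single H b := by
      intro φ a
      obtain ⟨b, hb⟩ := Finset.card_eq_one.1 ((hcard φ (single H a)).trans (by simp))
      exact ⟨b, Subtype.ext hb⟩
    choose f hf using hsingle
    have hinv : ∀ φ a, f φ.symm (f φ a) = a := by
      intro φ a
      apply single_injective (H := H)
      rw [← hf, ← hf, RelIso.symm_apply_apply]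
    have hinv' : ∀ φ a, f φ (f φ.symm a) = a := by
      intro φ a
      apply single_injective (H := H)
      rw [← hf, ← hf, RelIso.apply_symm_apply]
    -- Membership is `|{a} ∆ s| < |s| + 1`, hence it is preserved.
    have hmem : ∀ (s : FiniteClique H) (a : W),
        a ∈ s.1 ↔ (({a} : Finset W) ∆ s.1).card ≤ s.1.card := by
      intro s a
      by_cases ha : a ∈ s.1
      · simp only [ha, true_iff]
        refine Finset.card_le_card fun x hx => ?_
        simp only [Finset.mem_symmDiff, Finset.mem_singleton] at hx
        grind
      · have hd : Disjoint ({a} : Finset W) s.1 := by simpa using ha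
        rw [hd.symmDiff_eq_sup, Finset.sup_eq_union, Finset.card_union_of_disjoint hd]
        simp [ha]
    have hmem2 : ∀ (φ : simplexGraph H ≃g simplexGraph H) (s : FiniteClique H) (a : W),
        f φ a ∈ (φ s).1 ↔ a ∈ s.1 := by
      intro φ s a
      rw [hmem, hmem, hcard, ← coe_single (H := H) a, ← card_symmDiff_aut φ (single H a) s, hf,
        coe_single]
    have hadj : ∀ (φ : simplexGraph H ≃g simplexGraph H) {a b : W}, H.Adj a b →
        H.Adj (f φ a) (f φ b) := by
      intro φ a b h
      refine (φ (pair h)).2 ((hmem2 φ _ _).2 (by simp)) ((hmem2 φ _ _).2 (by simp)) fun heq => ?_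
      exact h.ne (by rw [← hinv φ a, heq, hinv])
    refine ⟨⟨⟨f φ, f φ.symm, hinv φ, hinv' φ⟩, fun {a b} => ⟨fun h => ?_, hadj φ⟩⟩, ?_⟩
    · have := hadj φ.symm h
      simpa [hinv] using this
    · ext s : 1
      refine Subtype.ext (Finset.ext fun a => ?_)
      rw [simplexGraphAut_apply, FiniteClique.mem_map, ← hmem2 φ]
      change f φ (f φ.symm a) ∈ _ ↔ _
      rw [hinv']

/-- For a bipartite graph `H` with three disjoint edges, `Aut(κ(H))` is `Aut(H)`. -/
noncomputable def simplexGraphAutEquiv (χ : H.Coloring Bool) (h3 : HasThreeDisjointEdges H) :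
    (H ≃g H) ≃* (simplexGraph H ≃g simplexGraph H) :=
  MulEquiv.ofBijective _ (simplexGraphAut_bijective χ h3)

end SimplexGraphAut

/-! ### Groups as automorphism groups of bipartite graphs -/

section Frucht

variable (Γ : Type u)

/-- The vertices of the Frucht graph of the group `Γ`. A colour is an element of `Γ × Bool`, the
colour `(g, i)` standing for right multiplication by `g`; the factor `Bool` provides two colours
even for the trivial group. -/
inductive FruchtVertex : Type u
  /-- the only vertex of degree one -/
  | leaf
  /-- the neighbour of the leaf -/
  | root
  /-- the vertices that record the initial segments of the set of colours -/
  | seg (c : Γ × Bool)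
  /-- the colours -/
  | col (c : Γ × Bool)
  /-- the origins of the coloured arrows `x ⟶ x * g` -/
  | src (x : Γ) (c : Γ × Bool)
  /-- the elements of the group -/
  | pt (x : Γ)
  /-- the midpoints of the arrows -/
  | mid (x : Γ) (c : Γ × Bool)
  /-- the ends of the arrows -/
  | tgt (x : Γ) (c : Γ × Bool)

namespace FruchtVertex

variable {Γ} [Group Γ]

/-- Left multiplication by an element of `Γ`. -/
def smul (g : Γ) : FruchtVertex Γ → FruchtVertex Γ
  | leaf => leaf
  | root => root
  | seg c => seg c
  | col c => col c
  | src x c => src (g * x) c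
  | pt x => pt (g * x)
  | mid x c => mid (g * x) c
  | tgt x c => tgt (g * x) c

lemma smul_smul (g h : Γ) (v : FruchtVertex Γ) : smul g (smul h v) = smul (g * h) v := by
  cases v <;> simp [smul, mul_assoc]

lemma one_smul (v : FruchtVertex Γ) : smul 1 v = v := by
  cases v <;> simp [smul]

variable [LinearOrder (Γ × Bool)]

/-- The edges of the Frucht graph, oriented away from the leaf. The arrow of colour `c = (g, i)`
from `x` to `x * g` is the path `pt x`, `src x c`, `mid x c`, `tgt x c`, `pt (x * g)`, with
`src x c` joined to the colour `c`; the vertex `seg d` is joined to the colours `c ≤ d`. -/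
def Arc : FruchtVertex Γ → FruchtVertex Γ → Prop
  | leaf, root => True
  | root, seg _ => True
  | seg d, col c => c ≤ d
  | col c, src _ d => c = d
  | src x _, pt y => x = y
  | src x c, mid y d => x = y ∧ c = d
  | mid x c, tgt y d => x = y ∧ c = d
  | pt y, tgt x c => y = x * c.1
  | _, _ => False

/-- The two colour classes of the Frucht graph. -/
def side : FruchtVertex Γ → Bool
  | leaf | seg _ | src _ _ | tgt _ _ => true
  | root | col _ | pt _ | mid _ _ => false

lemma Arc.side_ne {v w : FruchtVertex Γ} (h : Arc v w) : side v ≠ side w := by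
  cases v <;> cases w <;> simp_all [Arc, side]

/-- The Frucht graph of `Γ`. -/
def graph (Γ : Type u) [Group Γ] [LinearOrder (Γ × Bool)] : SimpleGraph (FruchtVertex Γ) where
  Adj v w := Arc v w ∨ Arc w v
  symm := ⟨fun _ _ h => h.symm⟩
  loopless := ⟨fun _ h => h.elim (fun h => h.side_ne rfl) fun h => h.side_ne rfl⟩

/-- The Frucht graph is bipartite. -/
def coloring (Γ : Type u) [Group Γ] [LinearOrder (Γ × Bool)] : (graph Γ).Coloring Bool :=
  SimpleGraph.Coloring.mk side fun h => h.elim (fun h => h.side_ne) fun h => h.side_ne.symm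

lemma hasThreeDisjointEdges : HasThreeDisjointEdges (graph Γ) := by
  refine ⟨![leaf, seg (1, true), mid 1 (1, true)], ![root, col (1, true), tgt 1 (1, true)], ?_, ?_⟩
  · intro i
    fin_cases i <;> simp [graph, Arc]
  · intro i j hij
    fin_cases i <;> fin_cases j <;> simp_all

lemma exists_adj (v : FruchtVertex Γ) : ∃ w, (graph Γ).Adj v w := by
  cases v with
  | leaf => exact ⟨root, by simp [graph, Arc]⟩
  | root => exact ⟨leaf, by simp [graph, Arc]⟩
  | seg c => exact ⟨root, by simp [graph, Arc]⟩
  | col c => exact ⟨seg c, by simp [graph, Arc]⟩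
  | src x c => exact ⟨pt x, by simp [graph, Arc]⟩
  | pt x => exact ⟨src x (1, true), by simp [graph, Arc]⟩
  | mid x c => exact ⟨tgt x c, by simp [graph, Arc]⟩
  | tgt x c => exact ⟨mid x c, by simp [graph, Arc]⟩

instance [Finite Γ] : Finite (FruchtVertex Γ) := by
  let f : FruchtVertex Γ → Fin 8 × Option Γ × Option (Γ × Bool)
    | leaf => (0, none, none)
    | root => (1, none, none)
    | seg c => (2, none, some c)
    | col c => (3, none, some c)
    | src x c => (4, some x, some c)
    | pt x => (5, some x, none)
    | mid x c => (6, some x, some c)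
    | tgt x c => (7, some x, some c)
  refine Finite.of_injective f fun v w h => ?_
  cases v <;> cases w <;> simp_all [f]

lemma arc_smul (g : Γ) (v w : FruchtVertex Γ) : Arc (smul g v) (smul g w) ↔ Arc v w := by
  cases v <;> cases w <;> simp [smul, Arc, mul_assoc]

/-- The action of `Γ` on the Frucht graph by left multiplication. -/
def action (Γ : Type u) [Group Γ] [LinearOrder (Γ × Bool)] : Γ →* (graph Γ ≃g graph Γ) where
  toFun g :=
    { toFun := smul g
      invFun := smul g⁻¹
      left_inv := fun v => by rw [smul_smul, inv_mul_cancel, one_smul]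
      right_inv := fun v => by rw [smul_smul, mul_inv_cancel, one_smul]
      map_rel_iff' := fun {v w} => by simp [graph, arc_smul] }
  map_one' := by
    ext v : 1
    exact one_smul v
  map_mul' g h := by
    ext v : 1
    exact (smul_smul g h v).symm

lemma action_apply (g : Γ) (v : FruchtVertex Γ) : action Γ g v = smul g v := rfl

section Rigidity

lemma adj_leaf {w : FruchtVertex Γ} : (graph Γ).Adj leaf w ↔ w = root := by
  cases w <;> simp [graph, Arc]

lemma adj_root {w : FruchtVertex Γ} : (graph Γ).Adj root w ↔ w = leaf ∨ ∃ c, w = seg c := by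
  cases w <;> simp [graph, Arc]

lemma adj_seg {w : FruchtVertex Γ} {d : Γ × Bool} :
    (graph Γ).Adj (seg d) w ↔ w = root ∨ ∃ c ≤ d, w = col c := by
  cases w <;> simp [graph, Arc]

lemma adj_col {w : FruchtVertex Γ} {c : Γ × Bool} :
    (graph Γ).Adj (col c) w ↔ (∃ d, c ≤ d ∧ w = seg d) ∨ ∃ x, w = src x c := by
  cases w <;> simp [graph, Arc, eq_comm]

lemma adj_src {w : FruchtVertex Γ} {x : Γ} {c : Γ × Bool} :
    (graph Γ).Adj (src x c) w ↔ w = col c ∨ w = pt x ∨ w = mid x c := by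
  cases w <;> simp [graph, Arc, eq_comm]

lemma adj_mid {w : FruchtVertex Γ} {x : Γ} {c : Γ × Bool} :
    (graph Γ).Adj (mid x c) w ↔ w = src x c ∨ w = tgt x c := by
  cases w <;> simp [graph, Arc, eq_comm]

lemma adj_tgt {w : FruchtVertex Γ} {x : Γ} {c : Γ × Bool} :
    (graph Γ).Adj (tgt x c) w ↔ w = mid x c ∨ w = pt (x * c.1) := by
  cases w <;> simp [graph, Arc, eq_comm]

variable (σ : graph Γ ≃g graph Γ)

/-- The leaf is the only vertex that has just one neighbour. -/
lemma aut_leaf : σ leaf = leaf := by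
  have huniq : ∀ w w', (graph Γ).Adj (σ leaf) w → (graph Γ).Adj (σ leaf) w' → w = w' := by
    intro w w' hw hw'
    have h : ∀ w, (graph Γ).Adj (σ leaf) w → w = σ root := by
      intro w hw
      have := σ.symm.map_rel_iff.2 hw
      rw [RelIso.symm_apply_apply, adj_leaf] at this
      rw [← this, RelIso.apply_symm_apply]
    rw [h w hw, h w' hw']
  generalize σ leaf = v at huniq
  cases v with
  | leaf => rfl
  | root => simpa using huniq leaf (seg (1, true)) (by simp [adj_root]) (by simp [adj_root])
  | seg c => simpa using huniq root (col c) (by simp [adj_seg]) (by simp [adj_seg])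
  | col c =>
    simpa using huniq (seg c) (src 1 c) (adj_col.2 (Or.inl ⟨c, le_rfl, rfl⟩)) (by simp [adj_col])
  | src x c => simpa using huniq (pt x) (mid x c) (by simp [adj_src]) (by simp [adj_src])
  | pt x =>
    simpa using huniq (src x (1, true)) (src x (1, false)) (by simp [graph, Arc])
      (by simp [graph, Arc])
  | mid x c => simpa using huniq (src x c) (tgt x c) (by simp [adj_mid]) (by simp [adj_mid])
  | tgt x c =>
    simpa using huniq (mid x c) (pt (x * c.1)) (by simp [adj_tgt]) (by simp [adj_tgt])

lemma aut_root : σ root = root := by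
  have : (graph Γ).Adj (σ leaf) (σ root) := σ.map_rel_iff.2 (adj_leaf.2 rfl)
  rwa [aut_leaf, adj_leaf] at this

lemma exists_aut_seg (c : Γ × Bool) : ∃ d, σ (seg c) = seg d := by
  have h : (graph Γ).Adj (σ root) (σ (seg c)) := σ.map_rel_iff.2 (adj_root.2 (Or.inr ⟨c, rfl⟩))
  rw [aut_root, adj_root] at h
  refine h.resolve_left fun h => ?_
  simpa using σ.injective (h.trans (aut_leaf σ).symm)

lemma exists_aut_col (c : Γ × Bool) : ∃ d, σ (col c) = col d := by
  obtain ⟨d, hd⟩ := exists_aut_seg σ c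
  have h : (graph Γ).Adj (σ (seg c)) (σ (col c)) :=
    σ.map_rel_iff.2 (adj_seg.2 (Or.inr ⟨c, le_rfl, rfl⟩))
  rw [hd, adj_seg] at h
  rcases h with h | ⟨e, -, h⟩
  · simpa using σ.injective (h.trans (aut_root σ).symm)
  · exact ⟨e, h⟩

lemma exists_aut_src (x : Γ) (c : Γ × Bool) :
    ∃ y, ∃ d, σ (src x c) = src y d ∧ σ (col c) = col d := by
  obtain ⟨d, hd⟩ := exists_aut_col σ c
  have h : (graph Γ).Adj (σ (col c)) (σ (src x c)) :=
    σ.map_rel_iff.2 (adj_col.2 (Or.inr ⟨x, rfl⟩))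
  rw [hd, adj_col] at h
  rcases h with ⟨e, -, h⟩ | ⟨y, h⟩
  · obtain ⟨e', he'⟩ := exists_aut_seg σ.symm e
    rw [← h, RelIso.symm_apply_apply] at he'
    simp at he'
  · exact ⟨y, d, h, hd⟩

/-- Unlike `mid y d`, the vertex `pt x` is adjacent to several vertices of the form `src y c`. -/
lemma aut_pt_ne_mid (x y : Γ) (d : Γ × Bool) : σ (pt x) ≠ mid y d := by
  intro h
  have key : ∀ i, σ (src x (1, i)) = src y d := by
    intro i
    obtain ⟨z, e, he, -⟩ := exists_aut_src σ x (1, i)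
    have h' : (graph Γ).Adj (σ (pt x)) (σ (src x (1, i))) :=
      σ.map_rel_iff.2 (adj_src.2 (Or.inr (Or.inl rfl))).symm
    rw [h, he, adj_mid] at h'
    simpa [he] using h'
  simpa using σ.injective ((key true).trans (key false).symm)

lemma aut_pt_mid (x : Γ) (c : Γ × Bool) :
    ∃ y d, σ (src x c) = src y d ∧ σ (col c) = col d ∧ σ (pt x) = pt y ∧ σ (mid x c) = mid y d := by
  obtain ⟨y, d, h1, h2⟩ := exists_aut_src σ x c
  have h3 : (graph Γ).Adj (σ (src x c)) (σ (pt x)) :=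
    σ.map_rel_iff.2 (adj_src.2 (Or.inr (Or.inl rfl)))
  have h4 : (graph Γ).Adj (σ (src x c)) (σ (mid x c)) :=
    σ.map_rel_iff.2 (adj_src.2 (Or.inr (Or.inr rfl)))
  rw [h1, adj_src] at h3 h4
  refine ⟨y, d, h1, h2, ?_, ?_⟩
  · rcases h3 with h | h | h
    · simpa using σ.injective (h.trans h2.symm)
    · exact h
    · exact absurd h (aut_pt_ne_mid σ _ _ _)
  · rcases h4 with h | h | h
    · simpa using σ.injective (h.trans h2.symm)
    · refine absurd ?_ (aut_pt_ne_mid σ.symm y x c)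
      rw [← h, RelIso.symm_apply_apply]
    · exact h

variable [WellFoundedLT (Γ × Bool)]

/-- A well-order is rigid, so that automorphisms fix the vertices `seg c`. -/
lemma aut_seg (c : Γ × Bool) : σ (seg c) = seg c := by
  choose f hf using fun σ : graph Γ ≃g graph Γ => exists_aut_seg σ
  have hmono : ∀ σ : graph Γ ≃g graph Γ, Monotone (f σ) := by
    intro σ c d hcd
    -- `c ≤ d` says that every colour adjacent to `seg c` is adjacent to `seg d`.
    obtain ⟨e, he⟩ := exists_aut_col σ.symm (f σ c)
    have h1 : (graph Γ).Adj (σ.symm (seg (f σ c))) (σ.symm (col (f σ c))) :=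
      σ.symm.map_rel_iff.2 (adj_seg.2 (Or.inr ⟨_, le_rfl, rfl⟩))
    rw [he, ← hf, RelIso.symm_apply_apply, adj_seg] at h1
    have h2 : (graph Γ).Adj (σ (seg d)) (σ (col e)) := by
      refine σ.map_rel_iff.2 (adj_seg.2 (Or.inr ⟨e, ?_, rfl⟩))
      simp only [reduceCtorEq, false_or] at h1
      obtain ⟨e', he', h⟩ := h1
      obtain rfl : e = e' := by simpa using h
      exact he'.trans hcd
    rw [hf, ← he, RelIso.apply_symm_apply, adj_seg] at h2
    simpa using h2
  have hinv : ∀ σ c, f σ.symm (f σ c) = c := by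
    intro σ c
    have : seg (f σ.symm (f σ c)) = seg c := by rw [← hf, ← hf, RelIso.symm_apply_apply]
    simpa using this
  let F : (Γ × Bool) ≃o (Γ × Bool) :=
    { toFun := f σ
      invFun := f σ.symm
      left_inv := hinv σ
      right_inv := fun c => by simpa using hinv σ.symm c
      map_rel_iff' := fun {a b} => ⟨fun h => by
          have h' : f σ.symm (f σ a) ≤ f σ.symm (f σ b) := hmono σ.symm h
          rwa [hinv, hinv] at h', fun h => hmono σ h⟩ }
  have hF : F c = c := by rw [Subsingleton.elim F (OrderIso.refl _)]; rfl
  rw [hf]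
  exact congrArg seg hF

lemma aut_col (c : Γ × Bool) : σ (col c) = col c := by
  obtain ⟨d, hd⟩ := exists_aut_col σ c
  have h1 : (graph Γ).Adj (σ (seg c)) (σ (col c)) :=
    σ.map_rel_iff.2 (adj_seg.2 (Or.inr ⟨c, le_rfl, rfl⟩))
  have h2 : (graph Γ).Adj (σ (seg d)) (σ (col c)) := by
    rw [aut_seg, hd]
    exact adj_seg.2 (Or.inr ⟨d, le_rfl, rfl⟩)
  rw [σ.map_rel_iff, adj_seg] at h2
  rw [aut_seg, hd, adj_seg] at h1
  simp only [reduceCtorEq, col.injEq, false_or, exists_eq_right'] at h1 h2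
  rw [hd, le_antisymm h1 h2]

lemma exists_eq_smul : ∃ g, ∀ v, σ v = smul g v := by
  obtain ⟨g, d, -, -, hg, -⟩ := aut_pt_mid σ 1 (1, true)
  have key : ∀ x, ∃ y, σ (pt x) = pt y ∧ ∀ c, σ (src x c) = src y c ∧ σ (mid x c) = mid y c ∧
      σ (tgt x c) = tgt y c := by
    intro x
    obtain ⟨y, -, -, -, hy, -⟩ := aut_pt_mid σ x (1, true)
    refine ⟨y, hy, fun c => ?_⟩
    obtain ⟨y', d, h1, h2, h3, h4⟩ := aut_pt_mid σ x c
    obtain rfl : c = d := by simpa using (aut_col σ c).symm.trans h2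
    obtain rfl : y = y' := by simpa using hy.symm.trans h3
    refine ⟨h1, h4, ?_⟩
    have h5 : (graph Γ).Adj (σ (mid x c)) (σ (tgt x c)) := σ.map_rel_iff.2 (adj_mid.2 (Or.inr rfl))
    rw [h4, adj_mid] at h5
    refine h5.resolve_left fun h => ?_
    simpa using σ.injective (h.trans h1.symm)
  have hpt : ∀ x, σ (pt x) = pt (g * x) := by
    intro x
    obtain ⟨y, hy, h⟩ := key 1
    obtain rfl : g = y := by simpa using hg.symm.trans hy
    have h6 : (graph Γ).Adj (σ (tgt 1 (x, true))) (σ (pt x)) :=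
      σ.map_rel_iff.2 (adj_tgt.2 (Or.inr (by simp)))
    obtain ⟨z, hz, -⟩ := key x
    rw [(h _).2.2, adj_tgt, hz] at h6
    simpa [hz] using h6
  have key' : ∀ x c, σ (src x c) = src (g * x) c ∧ σ (mid x c) = mid (g * x) c ∧
      σ (tgt x c) = tgt (g * x) c := by
    intro x
    obtain ⟨y, hy, h⟩ := key x
    obtain rfl : g * x = y := by simpa using (hpt x).symm.trans hy
    exact h
  refine ⟨g, fun v => ?_⟩
  cases v with
  | leaf => exact aut_leaf σ
  | root => exact aut_root σ
  | seg c => exact aut_seg σ c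
  | col c => exact aut_col σ c
  | src x c => exact (key' x c).1
  | pt x => exact hpt x
  | mid x c => exact (key' x c).2.1
  | tgt x c => exact (key' x c).2.2

/-- The automorphism group of the Frucht graph of `Γ` is `Γ`. -/
noncomputable def autEquiv (Γ : Type u) [Group Γ] [LinearOrder (Γ × Bool)]
    [WellFoundedLT (Γ × Bool)] : Γ ≃* (graph Γ ≃g graph Γ) :=
  MulEquiv.ofBijective (action Γ) <| by
    constructor
    · intro g h hgh
      simpa [action_apply, smul] using DFunLike.congr_fun hgh (pt 1)
    · intro σ
      obtain ⟨g, hg⟩ := exists_eq_smul σ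
      exact ⟨g, by ext v : 1; exact (hg v).symm⟩

end Rigidity

end FruchtVertex

/-- Frucht's theorem for arbitrary groups, with a bipartite graph. -/
lemma exists_bipartite_graph_aut (Γ : Type u) [Group Γ] :
    ∃ (W : Type u) (F : SimpleGraph W), Nonempty (Γ ≃* (F ≃g F)) ∧ (Finite Γ → Finite W) ∧
      Nonempty (F.Coloring Bool) ∧ HasThreeDisjointEdges F ∧ ∀ a, ∃ b, F.Adj a b := by
  obtain ⟨_, _⟩ := exists_wellFoundedLT (α := Γ × Bool)
  exact ⟨FruchtVertex Γ, FruchtVertex.graph Γ, ⟨FruchtVertex.autEquiv Γ⟩, fun _ => inferInstance,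
    ⟨FruchtVertex.coloring Γ⟩, FruchtVertex.hasThreeDisjointEdges, FruchtVertex.exists_adj⟩

end Frucht

/-! ### The space of functions supported by cliques -/

section CliqueSpace

open scoped Classical

variable {W : Type u} {H : SimpleGraph W}

/-- The space of functions `W → [0, 1]` whose support is a finite clique of `H`, with the
`l₁`-metric. It is a model of the geometric realization of `κ(H)`, in which a clique corresponds to
its indicator function. -/
structure CliqueSpace (H : SimpleGraph W) : Type u where
  /-- the underlying function -/
  toFinsupp : W →₀ ℝ
  mem_Icc : ∀ a, toFinsupp a ∈ Set.Icc (0 : ℝ) 1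
  isClique : H.IsClique (toFinsupp.support : Set W)

namespace CliqueSpace

instance : CoeFun (CliqueSpace H) fun _ => W → ℝ := ⟨fun x => x.toFinsupp⟩

@[ext] lemma ext {x y : CliqueSpace H} (h : ∀ a, x a = y a) : x = y := by
  cases x
  cases y
  congr
  exact Finsupp.ext h

/-- The support of a point, as a clique. -/
def supp (x : CliqueSpace H) : FiniteClique H := ⟨x.toFinsupp.support, x.isClique⟩

lemma mem_supp {x : CliqueSpace H} {a : W} : a ∈ x.supp.1 ↔ x a ≠ 0 := Finsupp.mem_support_iff

lemma nonneg (x : CliqueSpace H) (a : W) : 0 ≤ x a := (x.mem_Icc a).1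

lemma le_one (x : CliqueSpace H) (a : W) : x a ≤ 1 := (x.mem_Icc a).2

/-- The point given by a function with values in `[0, 1]` that vanishes off a clique. -/
noncomputable def ofFun (K : FiniteClique H) (f : W → ℝ) (h1 : ∀ a, f a ∈ Set.Icc (0 : ℝ) 1)
    (h0 : ∀ a, a ∉ K.1 → f a = 0) : CliqueSpace H :=
  ⟨Finsupp.onFinset K.1 f fun _ ha => by_contra fun h => ha (h0 _ h), h1,
    K.2.subset (Finset.coe_subset.2 Finsupp.support_onFinset_subset)⟩

@[simp] lemma ofFun_apply (K : FiniteClique H) (f : W → ℝ) (h1 : ∀ a, f a ∈ Set.Icc (0 : ℝ) 1)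
    (h0 : ∀ a, a ∉ K.1 → f a = 0) (a : W) : ofFun K f h1 h0 a = f a := rfl

lemma supp_ofFun_subset (K : FiniteClique H) (f : W → ℝ) (h1 : ∀ a, f a ∈ Set.Icc (0 : ℝ) 1)
    (h0 : ∀ a, a ∉ K.1 → f a = 0) : (ofFun K f h1 h0).supp.1 ⊆ K.1 := fun a ha =>
  by_contra fun h => mem_supp.1 ha (h0 a h)

lemma sum_eq_sum_of_subset {x y : CliqueSpace H} {S T : Finset W} (hST : S ⊆ T)
    (hx : x.supp.1 ⊆ S) (hy : y.supp.1 ⊆ S) :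
    ∑ a ∈ S, |x a - y a| = ∑ a ∈ T, |x a - y a| := by
  refine Finset.sum_subset hST fun a _ ha => ?_
  have h1 : x a = 0 := by_contra fun h => ha (hx (mem_supp.2 h))
  have h2 : y a = 0 := by_contra fun h => ha (hy (mem_supp.2 h))
  simp [h1, h2]

noncomputable instance : Dist (CliqueSpace H) :=
  ⟨fun x y => ∑ a ∈ x.supp.1 ∪ y.supp.1, |x a - y a|⟩

lemma dist_eq_sum {x y : CliqueSpace H} {S : Finset W} (hx : x.supp.1 ⊆ S) (hy : y.supp.1 ⊆ S) :
    dist x y = ∑ a ∈ S, |x a - y a| :=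
  sum_eq_sum_of_subset (Finset.union_subset hx hy) Finset.subset_union_left
    Finset.subset_union_right

noncomputable instance : MetricSpace (CliqueSpace H) where
  dist_self x := by simp [dist]
  dist_comm x y := by
    simp only [dist, Finset.union_comm x.supp.1, abs_sub_comm]
  dist_triangle x y z := by
    have hx : x.supp.1 ⊆ x.supp.1 ∪ y.supp.1 ∪ z.supp.1 := by
      rw [Finset.union_assoc]; exact Finset.subset_union_left
    have hy : y.supp.1 ⊆ x.supp.1 ∪ y.supp.1 ∪ z.supp.1 :=
      Finset.subset_union_right.trans Finset.subset_union_left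
    have hz : z.supp.1 ⊆ x.supp.1 ∪ y.supp.1 ∪ z.supp.1 := Finset.subset_union_right
    rw [dist_eq_sum hx hy, dist_eq_sum hy hz, dist_eq_sum hx hz, ← Finset.sum_add_distrib]
    exact Finset.sum_le_sum fun a _ => abs_sub_le _ _ _
  eq_of_dist_eq_zero {x y} h := by
    ext a
    by_cases ha : a ∈ x.supp.1 ∪ y.supp.1
    · have := (Finset.sum_eq_zero_iff_of_nonneg fun a _ => abs_nonneg (x a - y a)).1 h a ha
      exact sub_eq_zero.1 (abs_eq_zero.1 this)
    · rw [Finset.mem_union, mem_supp, mem_supp] at ha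
      push Not at ha
      rw [ha.1, ha.2]

lemma abs_sub_le_dist (x y : CliqueSpace H) (a : W) : |x a - y a| ≤ dist x y := by
  rw [dist_eq_sum (S := insert a (x.supp.1 ∪ y.supp.1))
    (Finset.subset_union_left.trans (Finset.subset_insert _ _))
    (Finset.subset_union_right.trans (Finset.subset_insert _ _))]
  exact Finset.single_le_sum (f := fun a => |x a - y a|) (fun a _ => abs_nonneg _)
    (Finset.mem_insert_self _ _)

lemma continuous_apply (a : W) : Continuous fun x : CliqueSpace H => x a := by
  refine (LipschitzWith.of_dist_le_mul (K := 1) fun x y => ?_).continuous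
  simpa [Real.dist_eq] using abs_sub_le_dist x y a

/-- The constant function `0`, which corresponds to the empty clique. -/
noncomputable def zero (H : SimpleGraph W) : CliqueSpace H :=
  ofFun (FiniteClique.empty H) 0 (by simp) (by simp)

@[simp] lemma zero_apply (a : W) : zero H a = 0 := rfl

/-- The function with value `r` at `a` and `0` elsewhere. -/
noncomputable def single (H : SimpleGraph W) (a : W) (r : ℝ) (hr : r ∈ Set.Icc (0 : ℝ) 1) :
    CliqueSpace H :=
  ofFun (FiniteClique.single H a) (fun b => if b = a then r else 0)
    (fun b => by split_ifs; exacts [hr, by simp]) (fun b hb => if_neg (by simpa using hb))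

lemma single_apply (a b : W) (r : ℝ) (hr : r ∈ Set.Icc (0 : ℝ) 1) :
    single H a r hr b = if b = a then r else 0 := rfl

/-- The vertex that corresponds to the clique `{a}`. -/
noncomputable def vertex (H : SimpleGraph W) (a : W) : CliqueSpace H := single H a 1 (by simp)

lemma vertex_apply (a b : W) : vertex H a b = if b = a then 1 else 0 := rfl

/-- The vertex that corresponds to the clique `{a, b}`. -/
noncomputable def corner {a b : W} (h : H.Adj a b) : CliqueSpace H :=
  ofFun (FiniteClique.pair h) (fun c => if c = a ∨ c = b then 1 else 0)
    (fun c => by split_ifs <;> simp) (fun c hc => if_neg (by simpa using hc))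

lemma corner_apply {a b : W} (h : H.Adj a b) (c : W) :
    corner h c = if c = a ∨ c = b then 1 else 0 := rfl

/-- The `l₁`-norm of a point, that is, its distance from `0`. -/
noncomputable def norm (x : CliqueSpace H) : ℝ := ∑ a ∈ x.supp.1, x a

lemma norm_eq_sum {x : CliqueSpace H} {S : Finset W} (hx : x.supp.1 ⊆ S) :
    x.norm = ∑ a ∈ S, x a :=
  Finset.sum_subset hx fun _ _ ha => by_contra fun h => ha (mem_supp.2 h)

lemma supp_zero : (zero H).supp.1 = ∅ := by
  ext a
  simp [mem_supp]

lemma supp_zero_subset (K : FiniteClique H) : (zero H).supp.1 ⊆ K.1 := by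
  rw [supp_zero]
  exact Finset.empty_subset _

lemma dist_zero_right (x : CliqueSpace H) : dist x (zero H) = x.norm := by
  rw [dist_eq_sum (S := x.supp.1) subset_rfl (by simp [supp_zero]), norm]
  exact Finset.sum_congr rfl fun a _ => by
    rw [zero_apply, sub_zero, abs_of_nonneg (x.nonneg a)]

lemma continuous_norm : Continuous (norm : CliqueSpace H → ℝ) := by
  have : (norm : CliqueSpace H → ℝ) = fun x => dist x (zero H) :=
    funext fun x => (dist_zero_right x).symm
  rw [this]
  fun_prop

lemma norm_nonneg (x : CliqueSpace H) : 0 ≤ x.norm := Finset.sum_nonneg fun a _ => x.nonneg a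

lemma apply_le_norm (x : CliqueSpace H) (a : W) : x a ≤ x.norm := by
  rw [norm_eq_sum (Finset.subset_insert a _)]
  exact Finset.single_le_sum (f := fun a => x a) (fun a _ => x.nonneg a)
    (Finset.mem_insert_self _ _)

lemma dist_eq_norm_sub_norm {x y : CliqueSpace H} (h : ∀ a, x a ≤ y a) :
    dist x y = y.norm - x.norm := by
  have hxy : x.supp.1 ⊆ y.supp.1 := fun a ha => by
    rw [mem_supp] at ha ⊢
    exact (lt_of_lt_of_le (lt_of_le_of_ne (x.nonneg a) ha.symm) (h a)).ne'
  rw [dist_eq_sum hxy subset_rfl, norm_eq_sum hxy, norm, ← Finset.sum_sub_distrib]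
  refine Finset.sum_congr rfl fun a _ => ?_
  rw [abs_sub_comm, abs_of_nonneg (sub_nonneg.2 (h a))]

lemma le_of_dist_eq {x y : CliqueSpace H} (h : dist x y = y.norm - x.norm) (a : W) :
    x a ≤ y a := by
  have hx : x.supp.1 ⊆ insert a (x.supp.1 ∪ y.supp.1) :=
    Finset.subset_union_left.trans (Finset.subset_insert _ _)
  have hy : y.supp.1 ⊆ insert a (x.supp.1 ∪ y.supp.1) :=
    Finset.subset_union_right.trans (Finset.subset_insert _ _)
  rw [dist_eq_sum hx hy, norm_eq_sum hx, norm_eq_sum hy, ← Finset.sum_sub_distrib] at h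
  have := (Finset.sum_eq_sum_iff_of_le fun a _ => by
    rw [abs_sub_comm]; exact le_abs_self (y a - x a)).1 h.symm a (Finset.mem_insert_self _ _)
  have h2 := abs_nonneg (x a - y a)
  linarith

/-- The pointwise minimum of two points. -/
noncomputable def inf (x y : CliqueSpace H) : CliqueSpace H :=
  ofFun x.supp (fun a => min (x a) (y a))
    (fun a => ⟨le_min (x.nonneg a) (y.nonneg a), (min_le_left _ _).trans (x.le_one a)⟩)
    (fun a ha => by
      have : x a = 0 := by_contra fun h => ha (mem_supp.2 h)
      simp [this, y.nonneg a])

lemma inf_apply (x y : CliqueSpace H) (a : W) : inf x y a = min (x a) (y a) := rfl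

/-- The pointwise minimum of two points lies metrically between them. -/
lemma dist_inf_add_dist_inf (x y : CliqueSpace H) :
    dist x (inf x y) + dist (inf x y) y = dist x y := by
  have hx : x.supp.1 ⊆ x.supp.1 ∪ y.supp.1 := Finset.subset_union_left
  have hy : y.supp.1 ⊆ x.supp.1 ∪ y.supp.1 := Finset.subset_union_right
  have hi : (inf x y).supp.1 ⊆ x.supp.1 ∪ y.supp.1 := fun a ha => by
    rw [mem_supp, inf_apply] at ha
    by_contra hcon
    rw [Finset.mem_union, mem_supp, mem_supp] at hcon
    push Not at hcon
    exact ha (by simp [hcon.1, hcon.2])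
  rw [dist_eq_sum hx hy, dist_eq_sum hx hi, dist_eq_sum hi hy, ← Finset.sum_add_distrib]
  refine Finset.sum_congr rfl fun a _ => ?_
  rw [inf_apply]
  rcases le_total (x a) (y a) with h | h
  · simp [min_eq_left h]
  · simp [min_eq_right h]

/-- The point of parameter `r` of the segment from `x` to `y`, two points of a common cube. -/
noncomputable def lineMap (K : FiniteClique H) (x y : CliqueSpace H) (hx : x.supp.1 ⊆ K.1)
    (hy : y.supp.1 ⊆ K.1) (r : unitInterval) : CliqueSpace H :=
  ofFun K (fun a => (1 - (r : ℝ)) * x a + r * y a)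
    (fun a => by
      have h0 := r.2.1
      have h1 := r.2.2
      have := x.nonneg a
      have := y.nonneg a
      have := x.le_one a
      have := y.le_one a
      constructor
      · nlinarith
      · nlinarith)
    (fun a ha => by
      have h1 : x a = 0 := by_contra fun h => ha (hx (mem_supp.2 h))
      have h2 : y a = 0 := by_contra fun h => ha (hy (mem_supp.2 h))
      simp [h1, h2])

lemma lineMap_apply (K : FiniteClique H) (x y : CliqueSpace H) (hx : x.supp.1 ⊆ K.1)
    (hy : y.supp.1 ⊆ K.1) (r : unitInterval) (a : W) :
    lineMap K x y hx hy r a = (1 - (r : ℝ)) * x a + r * y a := rfl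

lemma continuous_lineMap (K : FiniteClique H) (x y : CliqueSpace H) (hx : x.supp.1 ⊆ K.1)
    (hy : y.supp.1 ⊆ K.1) : Continuous (lineMap K x y hx hy) := by
  have hs : ∀ r, (lineMap K x y hx hy r).supp.1 ⊆ K.1 := fun r =>
    supp_ofFun_subset _ _ _ _
  refine (LipschitzWith.of_dist_le_mul (K := (dist x y).toNNReal) fun r s => ?_).continuous
  rw [Real.coe_toNNReal _ dist_nonneg, dist_eq_sum (hs r) (hs s), dist_eq_sum hx hy,
    Finset.sum_mul]
  refine Finset.sum_le_sum fun a _ => le_of_eq ?_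
  rw [lineMap_apply, lineMap_apply, Subtype.dist_eq, Real.dist_eq, ← abs_mul, abs_sub_comm]
  congr 1
  ring

/-- Two points of a common cube are joined in the complement of any point off the segment between
them. -/
lemma joinedIn_of_segment (K : FiniteClique H) {x y p : CliqueSpace H} (hx : x.supp.1 ⊆ K.1)
    (hy : y.supp.1 ⊆ K.1)
    (h : ∀ r : unitInterval, ∃ a, (1 - (r : ℝ)) * x a + r * y a ≠ p a) : JoinedIn {p}ᶜ x y := by
  refine ⟨⟨⟨lineMap K x y hx hy, continuous_lineMap K x y hx hy⟩, ?_, ?_⟩, fun r hr => ?_⟩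
  · ext a
    simp [lineMap_apply]
  · ext a
    simp [lineMap_apply]
  · obtain ⟨a, ha⟩ := h r
    exact ha (by rw [← lineMap_apply K x y hx hy, show lineMap K x y hx hy r = p from hr])

end CliqueSpace

end CliqueSpace

/-! ### Cubes of a simplex graph -/

section Frames

open scoped Classical symmDiff

variable {W : Type u} {H : SimpleGraph W} {n : ℕ}

/-- The cube `c` of `κ(H)` has base `s₀` and directions `τ`: the vertex `c ε` differs from `s₀` by
the presence or absence of the `τ i` with `ε i = true`. -/
structure IsFrame (c : hypercubeGraph n ↪g simplexGraph H) (s₀ : Finset W) (τ : Fin n → W) :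
    Prop where
  injective : Function.Injective τ
  apply_eq : ∀ ε, (c ε).1 = s₀ ∆ (Finset.univ.filter fun i => ε i = true).image τ

lemma hypercubeGraph_adj_insert {T : Finset (Fin n)} {i : Fin n} (hi : i ∉ T) :
    (hypercubeGraph n).Adj (fun j => decide (j ∈ T)) (fun j => decide (j ∈ insert i T)) := by
  change hammingDist _ _ = 1
  rw [hammingDist, Finset.card_eq_one]
  refine ⟨i, ?_⟩
  ext j
  simp only [Finset.mem_filter, Finset.mem_univ, true_and, Finset.mem_insert, Finset.mem_singleton,
    ne_eq, decide_eq_decide]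
  grind

/-- Every cube of `κ(H)` has a frame, because opposite edges of a `4`-cycle add or remove the same
vertex of `H`. -/
lemma exists_isFrame (c : hypercubeGraph n ↪g simplexGraph H) : ∃ s₀ τ, IsFrame c s₀ τ := by
  let d : Finset (Fin n) → Finset W := fun T => (c fun j => decide (j ∈ T)).1
  have hd : ∀ {T i}, i ∉ T → ∃ a, d T ∆ d (insert i T) = {a} := fun hi =>
    Finset.card_eq_one.1 (simplexGraph_adj.1 (c.map_rel_iff.2 (hypercubeGraph_adj_insert hi)))
  have hinj : Function.Injective d := by
    intro S T h
    have := c.injective (Subtype.ext h)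
    ext i
    simpa using congrFun this i
  choose τ hτ using fun i : Fin n => hd (Finset.notMem_empty i)
  have hstep : ∀ {A B : Finset W} {a : W}, A ∆ B = {a} → B = A ∆ {a} := by
    intro A B a h
    rw [← h, symmDiff_symmDiff_cancel_left]
  have hτinj : Function.Injective τ := by
    intro i j hij
    have h1 := hstep (hτ i)
    rw [hij, ← hstep (hτ j)] at h1
    simpa using hinj h1
  have key : ∀ T, d T = d ∅ ∆ T.image τ := by
    intro T
    induction T using Finset.strongInduction with
    | H T ih =>
      rcases T.eq_empty_or_nonempty with rfl | ⟨i, hi⟩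
      · rw [Finset.image_empty, symmDiff_empty_finset]
      obtain ⟨S, hiS, rfl⟩ : ∃ S, i ∉ S ∧ insert i S = T :=
        ⟨T.erase i, Finset.notMem_erase _ _, Finset.insert_erase hi⟩
      have him : ∀ R : Finset (Fin n), ∀ k, k ∉ R →
          (insert k R).image τ = R.image τ ∆ {τ k} := by
        intro R k hk
        ext a
        simp only [Finset.image_insert, Finset.mem_insert, Finset.mem_symmDiff,
          Finset.mem_singleton, Finset.mem_image]
        have : a = τ k → ¬ ∃ l ∈ R, τ l = a := by
          rintro rfl ⟨l, hl, h⟩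
          exact hk (hτinj h ▸ hl)
        grind
      have hS := ih S (Finset.ssubset_insert hiS)
      suffices h : d (insert i S) = d S ∆ {τ i} by
        rw [h, hS, him S i hiS, symmDiff_assoc]
      rcases S.eq_empty_or_nonempty with rfl | ⟨j, hj⟩
      · exact hstep (hτ i)
      obtain ⟨R, hjR, rfl⟩ : ∃ R, j ∉ R ∧ insert j R = S :=
        ⟨S.erase j, Finset.notMem_erase _ _, Finset.insert_erase hj⟩
      have hij : i ≠ j := by rintro rfl; simp at hiS
      have hiR : i ∉ R := fun h => hiS (Finset.mem_insert_of_mem h)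
      have hjiR : j ∉ insert i R := by simp [hij.symm, hjR]
      have hcomm : insert i (insert j R) = insert j (insert i R) := Finset.insert_comm _ _ _
      have hss1 : insert i R ⊂ insert i (insert j R) := by
        rw [hcomm]; exact Finset.ssubset_insert hjiR
      have hss2 : R ⊂ insert i (insert j R) := (Finset.ssubset_insert hiR).trans hss1
      have e1 : d (insert j R) = d R ∆ {τ j} := by
        rw [hS, ih R hss2, him R j hjR, symmDiff_assoc]
      have e2 : d (insert i R) = d R ∆ {τ i} := by
        rw [ih _ hss1, ih R hss2, him R i hiR, symmDiff_assoc]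
      obtain ⟨a, ha⟩ := hd hiS
      obtain ⟨b, hb⟩ := hd hjiR
      have ha' := hstep ha
      have hb' := hstep hb
      rw [← hcomm, e2, symmDiff_assoc] at hb'
      rw [e1, symmDiff_assoc] at ha'
      have hab : ({τ j} : Finset W) ∆ {a} = {τ i} ∆ {b} :=
        symmDiff_right_injective _ (ha'.symm.trans hb')
      have hbi : b ≠ τ i := by
        rintro rfl
        rw [symmDiff_self, Finset.bot_eq_empty, symmDiff_empty_finset] at hb'
        exact hss2.ne (hinj hb').symm
      have hai : a = τ i := by
        have h1 : τ i ∈ ({τ j} : Finset W) ∆ {a} := by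
          rw [hab, Finset.mem_symmDiff]
          simp [hbi.symm]
        have h2 : τ i ≠ τ j := fun h => hij (hτinj h)
        simp only [Finset.mem_symmDiff, Finset.mem_singleton] at h1
        grind
      rw [← hai]
      exact hstep ha
  refine ⟨d ∅, τ, hτinj, fun ε => ?_⟩
  rw [← key]
  simp [d]

namespace IsFrame

variable {c : hypercubeGraph n ↪g simplexGraph H} {s₀ : Finset W} {τ : Fin n → W}

lemma mem_apply_dir (hc : IsFrame c s₀ τ) (ε : Fin n → Bool) (i : Fin n) :
    τ i ∈ (c ε).1 ↔ ¬ (τ i ∈ s₀ ↔ ε i = true) := by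
  rw [hc.apply_eq, Finset.mem_symmDiff]
  have : τ i ∈ (Finset.univ.filter fun i => ε i = true).image τ ↔ ε i = true := by
    simp [hc.injective.eq_iff]
  rw [this]
  tauto

lemma mem_apply_of_notMem (hc : IsFrame c s₀ τ) (ε : Fin n → Bool) {a : W}
    (ha : a ∉ Set.range τ) : a ∈ (c ε).1 ↔ a ∈ s₀ := by
  rw [hc.apply_eq, Finset.mem_symmDiff]
  have : a ∉ (Finset.univ.filter fun i => ε i = true).image τ := fun h => by
    obtain ⟨i, -, hi⟩ := Finset.mem_image.1 h
    exact ha ⟨i, hi⟩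
  simp [this]

/-- The largest clique of a cube. -/
lemma top_mem (hc : IsFrame c s₀ τ) :
    (c fun i => decide (τ i ∉ s₀)).1 = s₀ ∪ Finset.univ.image τ := by
  ext a
  by_cases ha : a ∈ Set.range τ
  · obtain ⟨i, rfl⟩ := ha
    rw [hc.mem_apply_dir]
    simp
  · rw [hc.mem_apply_of_notMem _ ha]
    have : a ∉ Finset.univ.image τ := by simpa using ha
    simp [this]

end IsFrame

/-- The largest clique of a cube with a frame. -/
noncomputable def frameTop (c : hypercubeGraph n ↪g simplexGraph H) {s₀ : Finset W} {τ : Fin n → W}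
    (hc : IsFrame c s₀ τ) : FiniteClique H :=
  ⟨s₀ ∪ Finset.univ.image τ, hc.top_mem ▸ (c fun i => decide (τ i ∉ s₀)).2⟩

lemma hammingDist_eq_card_symmDiff (ε δ : Fin n → Bool) :
    hammingDist ε δ = ((Finset.univ.filter fun i => ε i = true) ∆
      (Finset.univ.filter fun i => δ i = true)).card := by
  rw [hammingDist]
  congr 1
  ext i
  simp only [Finset.mem_filter, Finset.mem_univ, true_and, Finset.mem_symmDiff]
  cases ε i <;> cases δ i <;> simp

/-- Any set `B \ A` of vertices, where `A ⊆ B` are cliques, is the set of directions of a cube. -/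
lemma exists_cube (A : Finset W) (B : FiniteClique H) (hAB : A ⊆ B.1) :
    ∃ (n : ℕ) (c : hypercubeGraph n ↪g simplexGraph H) (τ : Fin n → W),
      IsFrame c A τ ∧ Set.range τ = (↑(B.1 \ A) : Set W) := by
  let τ : Fin (B.1 \ A).card → W := fun i => ((B.1 \ A).equivFin.symm i).1
  have hτ : Function.Injective τ := Subtype.val_injective.comp (Equiv.injective _)
  have hmem : ∀ i, τ i ∈ B.1 \ A := fun i => ((B.1 \ A).equivFin.symm i).2
  let S : (Fin (B.1 \ A).card → Bool) → Finset W := fun ε =>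
    A ∆ (Finset.univ.filter fun i => ε i = true).image τ
  have hS : ∀ ε, S ε ⊆ B.1 := by
    intro ε a ha
    rcases Finset.mem_symmDiff.1 ha with h | h
    · exact hAB h.1
    · obtain ⟨i, -, rfl⟩ := Finset.mem_image.1 h.1
      exact (Finset.mem_sdiff.1 (hmem i)).1
  have hcard : ∀ ε δ, (S ε ∆ S δ).card = hammingDist ε δ := by
    intro ε δ
    rw [hammingDist_eq_card_symmDiff, ← Finset.card_image_of_injective _ hτ,
      Finset.image_symmDiff _ _ hτ]
    congr 1
    simp only [S]
    rw [symmDiff_symmDiff_symmDiff_comm, symmDiff_self, bot_symmDiff]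
  refine ⟨_, ⟨⟨fun ε => B.ofSubset (S ε) (hS ε), fun ε δ h => ?_⟩, fun {ε δ} => ?_⟩, τ,
    ⟨hτ, fun ε => rfl⟩, ?_⟩
  · have : S ε = S δ := congrArg Subtype.val h
    have h0 := hcard ε δ
    rw [this, symmDiff_self] at h0
    exact hammingDist_eq_zero.1 h0.symm
  · change (simplexGraph H).Adj (B.ofSubset (S ε) (hS ε)) (B.ofSubset (S δ) (hS δ)) ↔
      hammingDist ε δ = 1
    rw [simplexGraph_adj, ← hcard]
    rfl
  · ext a
    constructor
    · rintro ⟨i, rfl⟩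
      exact hmem i
    · intro ha
      exact ⟨(B.1 \ A).equivFin ⟨a, ha⟩, by simp [τ]⟩

end Frames

/-! ### The geometric realization of a simplex graph -/

section RealizationModel

open scoped Classical symmDiff

open CliqueSpace

variable {W : Type u} {H : SimpleGraph W} {n : ℕ}

namespace CliqueSpace

/-- The barycentric weight of the vertex `v` of `κ(H)` at the point `x`. -/
noncomputable def weight (x : CliqueSpace H) (v : FiniteClique H) : ℝ :=
  ∏ a ∈ x.supp.1 ∪ v.1, if a ∈ v.1 then x a else 1 - x a

lemma apply_eq_zero {x : CliqueSpace H} {a : W} (h : a ∉ x.supp.1) : x a = 0 :=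
  by_contra fun h' => h (mem_supp.2 h')

lemma weight_eq_prod {x : CliqueSpace H} {v : FiniteClique H} {S : Finset W}
    (hx : x.supp.1 ⊆ S) (hv : v.1 ⊆ S) :
    x.weight v = ∏ a ∈ S, if a ∈ v.1 then x a else 1 - x a := by
  refine Finset.prod_subset (Finset.union_subset hx hv) fun a _ ha => ?_
  rw [Finset.mem_union, not_or] at ha
  rw [if_neg ha.2, apply_eq_zero ha.1, sub_zero]

lemma weight_ne_zero_subset {x : CliqueSpace H} {v : FiniteClique H} (h : x.weight v ≠ 0) :
    v.1 ⊆ x.supp.1 := by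
  intro a ha
  rw [mem_supp]
  intro h0
  exact h (Finset.prod_eq_zero (Finset.mem_union_right _ ha) (by rw [if_pos ha, h0]))

lemma weight_supp (x : CliqueSpace H) : x.weight x.supp = ∏ a ∈ x.supp.1, x a := by
  rw [weight_eq_prod subset_rfl subset_rfl]
  exact Finset.prod_congr rfl fun a ha => if_pos ha

lemma weight_supp_ne_zero (x : CliqueSpace H) : x.weight x.supp ≠ 0 := by
  rw [weight_supp]
  exact Finset.prod_ne_zero_iff.2 fun a ha => mem_supp.1 ha

/-- The support of `x` is the largest clique of positive weight, and the value of `x` at a point `a`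
of the support can be read off from the weights of this clique with and without `a`. -/
lemma weight_injective : Function.Injective (weight : CliqueSpace H → FiniteClique H → ℝ) := by
  intro x y h
  have hs : x.supp.1 = y.supp.1 :=
    Finset.Subset.antisymm (weight_ne_zero_subset (by rw [← h]; exact weight_supp_ne_zero x))
      (weight_ne_zero_subset (by rw [h]; exact weight_supp_ne_zero y))
  have key : ∀ (z : CliqueSpace H) (a : W) (ha : a ∈ z.supp.1),
      z a * z.weight (z.supp.ofSubset (z.supp.1.erase a) (Finset.erase_subset _ _)) =
        (1 - z a) * z.weight z.supp := by
    intro z a ha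
    rw [weight_supp, weight_eq_prod (S := z.supp.1) subset_rfl (Finset.erase_subset _ _),
      ← Finset.mul_prod_erase _ _ ha, ← Finset.mul_prod_erase _ (fun a => z a) ha]
    have : ∀ b ∈ z.supp.1.erase a,
        (if b ∈ (z.supp.ofSubset (z.supp.1.erase a) (Finset.erase_subset _ _)).1 then z b
          else 1 - z b) = z b := fun b hb => if_pos hb
    rw [Finset.prod_congr rfl this, if_neg (by simp)]
    ring
  ext a
  by_cases ha : a ∈ x.supp.1
  · have ha' := hs ▸ ha
    have h1 := key x a ha
    have h2 := key y a ha'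
    have e1 : y.supp = x.supp := Subtype.ext hs.symm
    rw [e1, ← h] at h2
    have hpos := weight_supp_ne_zero x
    generalize x.weight x.supp = p at h1 h2 hpos
    generalize x.weight _ = q at h1 h2
    have hx : x a ≠ 0 := mem_supp.1 ha
    have hy : y a ≠ 0 := mem_supp.1 ha'
    have h3 : y a * ((1 - x a) * p) = x a * ((1 - y a) * p) := by
      rw [← h1, ← h2]; ring
    have h4 : p * (y a - x a) = 0 := by linear_combination h3
    rcases mul_eq_zero.1 h4 with h | h
    · exact absurd h hpos
    · linarith
  · rw [apply_eq_zero ha, apply_eq_zero (hs ▸ ha)]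

/-- The points of the cube spanned by the cliques between `A` and `B`. -/
def box (H : SimpleGraph W) (A B : Finset W) : Set (CliqueSpace H) :=
  {x | (∀ a ∈ A, x a = 1) ∧ ∀ a, a ∉ B → x a = 0}

lemma box_inter_box (A B A' B' : Finset W) :
    box H A B ∩ box H A' B' = box H (A ∪ A') (B ∩ B') := by
  ext x
  simp only [box, Set.mem_inter_iff, Set.mem_ofPred_eq, Finset.mem_union, Finset.mem_inter]
  constructor
  · rintro ⟨⟨h1, h2⟩, h3, h4⟩
    exact ⟨fun a ha => ha.elim (h1 a) (h3 a), fun a ha => by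
      by_cases h : a ∈ B
      · exact h4 a fun h' => ha ⟨h, h'⟩
      · exact h2 a h⟩
  · rintro ⟨h1, h2⟩
    exact ⟨⟨fun a ha => h1 a (Or.inl ha), fun a ha => h2 a fun h => ha h.1⟩,
      fun a ha => h1 a (Or.inr ha), fun a ha => h2 a fun h => ha h.2⟩

lemma subset_of_box_nonempty {A B : Finset W} (h : (box H A B).Nonempty) : A ⊆ B := by
  obtain ⟨x, h1, h2⟩ := h
  intro a ha
  by_contra hb
  have := h1 a ha
  rw [h2 a hb] at this
  norm_num at this

end CliqueSpace

/-- The value at a direction `a` of a cube with base `s₀` of the point whose coordinate in this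
direction is `r`. It is `1 - r` if `a` belongs to the base, because the base has coordinate `0`. -/
noncomputable def frameValue (s₀ : Finset W) (a : W) (r : ℝ) : ℝ := if a ∈ s₀ then 1 - r else r

lemma frameValue_frameValue (s₀ : Finset W) (a : W) (r : ℝ) :
    frameValue s₀ a (frameValue s₀ a r) = r := by
  unfold frameValue
  split_ifs <;> ring

lemma frameValue_mem (s₀ : Finset W) (a : W) {r : ℝ} (hr : r ∈ Set.Icc (0 : ℝ) 1) :
    frameValue s₀ a r ∈ Set.Icc (0 : ℝ) 1 := by
  unfold frameValue
  split_ifs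
  · exact ⟨by linarith [hr.2], by linarith [hr.1]⟩
  · exact hr

namespace IsFrame

variable {c : hypercubeGraph n ↪g simplexGraph H} {s₀ : Finset W} {τ : Fin n → W}

/-- The smallest clique of a cube with a frame. -/
noncomputable def bot (s₀ : Finset W) (τ : Fin n → W) : Finset W := s₀ \ Finset.univ.image τ

/-- The point of `CliqueSpace H` with coordinates `s` in a framed cube. -/
noncomputable def point (hc : IsFrame c s₀ τ) (s : Fin n → Set.Icc (0 : ℝ) 1) : CliqueSpace H :=
  CliqueSpace.ofFun (frameTop c hc)
    (fun a => if h : ∃ i, τ i = a then frameValue s₀ a (s h.choose) else if a ∈ s₀ then 1 else 0)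
    (fun a => by
      split_ifs
      · exact frameValue_mem _ _ (s _).2
      · simp
      · simp)
    (fun a ha => by
      have ha' : a ∉ s₀ ∧ ∀ i, τ i ≠ a := by simpa [frameTop] using ha
      rw [dif_neg (by simpa using ha'.2), if_neg ha'.1])

lemma point_dir (hc : IsFrame c s₀ τ) (s : Fin n → Set.Icc (0 : ℝ) 1) (i : Fin n) :
    hc.point s (τ i) = frameValue s₀ (τ i) (s i) := by
  have h : ∃ j, τ j = τ i := ⟨i, rfl⟩
  have hi : h.choose = i := hc.injective h.choose_spec
  rw [point, CliqueSpace.ofFun_apply, dif_pos h, hi]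

lemma point_of_notMem (hc : IsFrame c s₀ τ) (s : Fin n → Set.Icc (0 : ℝ) 1) {a : W}
    (ha : a ∉ Set.range τ) : hc.point s a = if a ∈ s₀ then 1 else 0 := by
  have ha' : ¬ ∃ i, τ i = a := ha
  rw [point, CliqueSpace.ofFun_apply, dif_neg ha']

lemma point_supp_subset (hc : IsFrame c s₀ τ) (s : Fin n → Set.Icc (0 : ℝ) 1) :
    (hc.point s).supp.1 ⊆ (frameTop c hc).1 := supp_ofFun_subset _ _ _ _

/-- A framed cube parametrizes the box between its smallest and its largest clique. -/
lemma exists_point_eq (hc : IsFrame c s₀ τ) {x : CliqueSpace H}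
    (hx : x ∈ box H (bot s₀ τ) (frameTop c hc).1) :
    ∃ s, hc.point s = x ∧ ∀ i, (s i : ℝ) = frameValue s₀ (τ i) (x (τ i)) := by
  refine ⟨fun i => ⟨frameValue s₀ (τ i) (x (τ i)), frameValue_mem _ _ (x.mem_Icc _)⟩, ?_,
    fun i => rfl⟩
  ext a
  by_cases ha : a ∈ Set.range τ
  · obtain ⟨i, rfl⟩ := ha
    rw [point_dir, frameValue_frameValue]
  · rw [point_of_notMem _ _ ha]
    have ha' : a ∉ Finset.univ.image τ := by simpa using ha
    split_ifs with h
    · exact (hx.1 a (Finset.mem_sdiff.2 ⟨h, ha'⟩)).symm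
    · refine (hx.2 a ?_).symm
      simp only [frameTop, Finset.mem_union, not_or]
      exact ⟨h, ha'⟩

lemma point_mem_box (hc : IsFrame c s₀ τ) (s : Fin n → Set.Icc (0 : ℝ) 1) :
    hc.point s ∈ box H (bot s₀ τ) (frameTop c hc).1 := by
  refine ⟨fun a ha => ?_, fun a ha => apply_eq_zero fun h => ha (hc.point_supp_subset s h)⟩
  rw [bot, Finset.mem_sdiff] at ha
  rw [point_of_notMem _ _ (by simpa using ha.2), if_pos ha.1]

/-- In a framed cube the multilinear weights are those of the model. -/
lemma cubePoint_eq_weight (hc : IsFrame c s₀ τ) (s : Fin n → Set.Icc (0 : ℝ) 1) :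
    cubePoint c s = (hc.point s).weight := by
  funext v
  by_cases hv : ∃ ε, c ε = v
  · obtain ⟨ε, rfl⟩ := hv
    have h1 : cubePoint c s (c ε) = ∏ i, (if ε i then (s i : ℝ) else 1 - (s i : ℝ)) := by
      unfold cubePoint
      rw [Finset.sum_eq_single ε]
      · simp
      · intro δ _ hδ
        rw [if_neg fun h => hδ (c.injective h)]
      · simp
    have h2 : (c ε).1 ⊆ (frameTop c hc).1 := by
      intro a ha
      by_cases har : a ∈ Set.range τ
      · exact Finset.mem_union_right _ (by simpa using har)
      · exact Finset.mem_union_left _ ((hc.mem_apply_of_notMem ε har).1 ha)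
    rw [h1, weight_eq_prod (hc.point_supp_subset s) h2]
    have h3 : Finset.univ.image τ ⊆ (frameTop c hc).1 := Finset.subset_union_right
    rw [← Finset.prod_subset h3, Finset.prod_image fun i _ j _ h => hc.injective h]
    · refine Finset.prod_congr rfl fun i _ => ?_
      have := hc.mem_apply_dir ε i
      rw [point_dir, frameValue]
      by_cases hs : τ i ∈ s₀ <;> by_cases hε : ε i = true <;> simp [this, hs, hε]
    · intro a _ ha
      have har : a ∉ Set.range τ := by simpa using ha
      have := hc.mem_apply_of_notMem ε har
      rw [point_of_notMem _ _ har]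
      by_cases h : a ∈ s₀ <;> simp [this, h]
  · have h1 : cubePoint c s v = 0 := Finset.sum_eq_zero fun ε _ => if_neg fun h => hv ⟨ε, h⟩
    rw [h1]
    obtain ⟨a, har, ha⟩ : ∃ a, a ∉ Set.range τ ∧ ¬ (a ∈ v.1 ↔ a ∈ s₀) := by
      by_contra! hcon
      refine hv ⟨fun i => decide (¬ (τ i ∈ v.1 ↔ τ i ∈ s₀)), Subtype.ext (Finset.ext fun a => ?_)⟩
      by_cases har : a ∈ Set.range τ
      · obtain ⟨i, rfl⟩ := har
        rw [hc.mem_apply_dir, decide_eq_true_iff]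
        tauto
      · rw [hc.mem_apply_of_notMem _ har, hcon a har]
    symm
    rw [weight_eq_prod (S := (frameTop c hc).1 ∪ v.1)
      ((hc.point_supp_subset s).trans Finset.subset_union_left) Finset.subset_union_right]
    refine Finset.prod_eq_zero (i := a) ?_ ?_
    · rw [Finset.mem_union, frameTop, Finset.mem_union]
      tauto
    · rw [point_of_notMem _ _ har]
      by_cases h : a ∈ v.1 <;> by_cases h' : a ∈ s₀ <;> simp_all

lemma sum_edist (hc : IsFrame c s₀ τ) (s t : Fin n → Set.Icc (0 : ℝ) 1) :
    ∑ i, edist (s i) (t i) = edist (hc.point s) (hc.point t) := by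
  rw [edist_dist, dist_eq_sum (hc.point_supp_subset s) (hc.point_supp_subset t)]
  simp only [edist_dist]
  rw [← ENNReal.ofReal_sum_of_nonneg fun i _ => dist_nonneg]
  congr 1
  have h3 : Finset.univ.image τ ⊆ (frameTop c hc).1 := Finset.subset_union_right
  rw [← Finset.sum_subset h3, Finset.sum_image fun i _ j _ h => hc.injective h]
  · refine Finset.sum_congr rfl fun i _ => ?_
    rw [point_dir, point_dir, Subtype.dist_eq, Real.dist_eq, frameValue, frameValue]
    split_ifs
    · rw [abs_sub_comm]
      congr 1
      ring
    · rfl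
  · intro a _ ha
    have har : a ∉ Set.range τ := by simpa using ha
    rw [point_of_notMem _ _ har, point_of_notMem _ _ har, sub_self, abs_zero]

end IsFrame

namespace CliqueSpace

lemma exists_cube_point_eq (x : CliqueSpace H) :
    ∃ (n : ℕ) (c : hypercubeGraph n ↪g simplexGraph H) (s : Fin n → Set.Icc (0 : ℝ) 1),
      x.weight = cubePoint c s := by
  obtain ⟨n, c, τ, hc, hr⟩ := exists_cube ∅ x.supp (Finset.empty_subset _)
  obtain ⟨s, hs, -⟩ := hc.exists_point_eq (x := x) ⟨by simp [IsFrame.bot], fun a ha => by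
    refine apply_eq_zero fun h => ha (Finset.mem_union_right _ ?_)
    have : a ∈ Set.range τ := by rw [hr]; simpa using h
    simpa using this⟩
  exact ⟨n, c, s, by rw [hc.cubePoint_eq_weight, hs]⟩

/-- The point of the geometric realization of `κ(H)` that corresponds to a point of the model. -/
noncomputable def toRealization (x : CliqueSpace H) : Realization (simplexGraph H) :=
  ⟨x.weight, x.exists_cube_point_eq⟩

lemma toRealization_injective :
    Function.Injective (toRealization : CliqueSpace H → Realization (simplexGraph H)) :=
  fun _ _ h => weight_injective (congrArg Subtype.val h)

end CliqueSpace

namespace IsFrame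

variable {c : hypercubeGraph n ↪g simplexGraph H} {s₀ : Finset W} {τ : Fin n → W}

lemma chart_eq (hc : IsFrame c s₀ τ) (s : Fin n → Set.Icc (0 : ℝ) 1) :
    (solidCube c).chart s = (hc.point s).toRealization :=
  Subtype.ext (hc.cubePoint_eq_weight s)

lemma carrier_eq (hc : IsFrame c s₀ τ) :
    (solidCube c).carrier = toRealization '' box H (bot s₀ τ) (frameTop c hc).1 := by
  ext w
  constructor
  · rintro ⟨s, rfl⟩
    exact ⟨_, hc.point_mem_box s, (hc.chart_eq s).symm⟩
  · rintro ⟨x, hx, rfl⟩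
    obtain ⟨s, rfl, -⟩ := hc.exists_point_eq hx
    exact ⟨s, hc.chart_eq s⟩

lemma edist_le_localEDist (hc : IsFrame c s₀ τ) (x y : CliqueSpace H) :
    edist x y ≤ (solidCube c).localEDist x.toRealization y.toRealization := by
  refine le_iInf fun s => le_iInf fun t => le_iInf fun hs => le_iInf fun ht => ?_
  rw [← toRealization_injective ((hc.chart_eq s).symm.trans hs),
    ← toRealization_injective ((hc.chart_eq t).symm.trans ht)]
  exact (hc.sum_edist s t).ge

lemma localEDist_eq (hc : IsFrame c s₀ τ) {x y : CliqueSpace H}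
    (hx : x.toRealization ∈ (solidCube c).carrier) (hy : y.toRealization ∈ (solidCube c).carrier) :
    (solidCube c).localEDist x.toRealization y.toRealization = edist x y := by
  refine le_antisymm ?_ (hc.edist_le_localEDist x y)
  obtain ⟨s, hs⟩ := hx
  obtain ⟨t, ht⟩ := hy
  refine iInf_le_of_le s <| iInf_le_of_le t <| iInf_le_of_le hs <| iInf_le_of_le ht ?_
  rw [← toRealization_injective ((hc.chart_eq s).symm.trans hs),
    ← toRealization_injective ((hc.chart_eq t).symm.trans ht)]
  exact (hc.sum_edist s t).le

end IsFrame

namespace CliqueSpace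

lemma toRealization_surjective :
    Function.Surjective (toRealization : CliqueSpace H → Realization (simplexGraph H)) := by
  rintro ⟨w, n, c, s, rfl⟩
  obtain ⟨s₀, τ, hc⟩ := exists_isFrame c
  exact ⟨hc.point s, Subtype.ext (hc.cubePoint_eq_weight s).symm⟩

lemma exists_cell (A : Finset W) (B : FiniteClique H) (hAB : A ⊆ B.1) :
    ∃ C ∈ realizationCells (simplexGraph H), C.carrier = toRealization '' box H A B.1 := by
  obtain ⟨n, c, τ, hc, hr⟩ := exists_cube A B hAB
  refine ⟨_, ⟨n, c, rfl⟩, ?_⟩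
  have himg : Finset.univ.image τ = B.1 \ A := by
    rw [← Finset.coe_inj, ← hr]
    simp
  have h1 : IsFrame.bot A τ = A := by
    rw [IsFrame.bot, himg]
    exact Finset.sdiff_eq_self_of_disjoint Finset.disjoint_sdiff
  have h2 : (frameTop c hc).1 = B.1 := by
    change A ∪ Finset.univ.image τ = B.1
    rw [himg, Finset.union_sdiff_of_subset hAB]
  rw [hc.carrier_eq, h1, h2]

lemma le_iInf_localEDist (x y : CliqueSpace H) :
    edist x y ≤ ⨅ C ∈ realizationCells (simplexGraph H),
      C.localEDist x.toRealization y.toRealization := by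
  refine le_iInf₂ fun C hC => ?_
  obtain ⟨n, c, rfl⟩ := hC
  obtain ⟨s₀, τ, hc⟩ := exists_isFrame c
  exact hc.edist_le_localEDist x y

lemma intrinsicEDist_le {x y : CliqueSpace H} (h : ∀ a, x a ≤ y a) :
    intrinsicEDist (realizationCells (simplexGraph H)) x.toRealization y.toRealization ≤
      edist x y := by
  obtain ⟨C, hC, hcar⟩ := exists_cell ∅ y.supp (Finset.empty_subset _)
  have hy : y.toRealization ∈ C.carrier := by
    rw [hcar]
    exact ⟨y, ⟨by simp, fun a => apply_eq_zero⟩, rfl⟩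
  have hx : x.toRealization ∈ C.carrier := by
    rw [hcar]
    exact ⟨x, ⟨by simp, fun a ha => le_antisymm ((h a).trans (apply_eq_zero ha).le) (x.nonneg a)⟩,
      rfl⟩
  refine iInf_le_of_le 1 <| iInf_le_of_le (fun i => if i = 0 then x.toRealization
    else y.toRealization) <| iInf_le_of_le (by simp) <| iInf_le_of_le (by simp) ?_
  simp only [Finset.sum_range_one, if_true, zero_add, one_ne_zero, if_false]
  refine iInf₂_le_of_le C hC ?_
  obtain ⟨n, c, rfl⟩ := hC
  obtain ⟨s₀, τ, hc⟩ := exists_isFrame c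
  exact (hc.localEDist_eq hx hy).le

/-- The intrinsic `l₁`-metric of the realization is the `l₁`-metric of the model. Chains are not
shorter by the triangle inequality, and the chain `x, min x y, y` attains the distance. -/
lemma edist_toRealization (x y : CliqueSpace H) :
    edist x.toRealization y.toRealization = edist x y := by
  refine le_antisymm ?_ ?_
  · refine (intrinsicEDist_triangle _ _ (inf x y).toRealization _).trans ?_
    have h1 : edist x y = edist x (inf x y) + edist (inf x y) y := by
      rw [edist_dist, edist_dist, edist_dist, ← ENNReal.ofReal_add dist_nonneg dist_nonneg,
        dist_inf_add_dist_inf]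
    rw [h1, intrinsicEDist_comm, edist_comm x]
    exact add_le_add (intrinsicEDist_le fun a => min_le_left _ _)
      (intrinsicEDist_le fun a => min_le_right _ _)
  · refine le_iInf fun n => le_iInf fun p => le_iInf fun h0 => le_iInf fun hn => ?_
    choose q hq using fun i => toRealization_surjective (p i)
    have e0 : q 0 = x := toRealization_injective ((hq 0).trans h0)
    have en : q n = y := toRealization_injective ((hq n).trans hn)
    rw [← e0, ← en]
    refine (edist_le_range_sum_edist q n).trans (Finset.sum_le_sum fun i _ => ?_)
    rw [← hq, ← hq]
    exact le_iInf_localEDist _ _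

/-- The geometric realization of `κ(H)` is isometric to the model. -/
noncomputable def isometryEquivRealization (H : SimpleGraph W) :
    CliqueSpace H ≃ᵢ Realization (simplexGraph H) where
  toEquiv := Equiv.ofBijective _ ⟨toRealization_injective, toRealization_surjective⟩
  isometry_toFun := edist_toRealization

end CliqueSpace

end RealizationModel

/-! ### The realization as a rectangular complex -/

section RectangularComplex

open scoped Classical symmDiff

open CliqueSpace

variable {W : Type u} {H : SimpleGraph W} {n : ℕ}

namespace IsFrame

variable {c : hypercubeGraph n ↪g simplexGraph H} {s₀ : Finset W} {τ : Fin n → W}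

lemma notMem_bot (s₀ : Finset W) (τ : Fin n → W) (i : Fin n) : τ i ∉ bot s₀ τ := fun h =>
  (Finset.mem_sdiff.1 h).2 (Finset.mem_image_of_mem _ (Finset.mem_univ _))

lemma mem_top (hc : IsFrame c s₀ τ) (i : Fin n) : τ i ∈ (frameTop c hc).1 :=
  Finset.mem_union_right _ (Finset.mem_image_of_mem _ (Finset.mem_univ _))

/-- The set of directions of a framed cube in which the face `φ` has the value `1` (for `b = true`)
or `0` (for `b = false`). -/
noncomputable def fixed (s₀ : Finset W) (τ : Fin n → W) (φ : Fin n → Option Bool) (b : Bool) :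
    Finset W :=
  (Finset.univ.filter fun i => φ i = some (xor b (decide (τ i ∈ s₀)))).image τ

lemma mem_fixed (hc : IsFrame c s₀ τ) {φ : Fin n → Option Bool} {b : Bool} {i : Fin n} :
    τ i ∈ fixed s₀ τ φ b ↔ φ i = some (xor b (decide (τ i ∈ s₀))) := by
  simp [fixed, hc.injective.eq_iff]

lemma face_eq (hc : IsFrame c s₀ τ) (φ : Fin n → Option Bool) :
    (solidCube c).face φ = toRealization ''
      box H (bot s₀ τ ∪ fixed s₀ τ φ true) ((frameTop c hc).1 \ fixed s₀ τ φ false) := by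
  have hfix : ∀ {a b}, a ∈ fixed s₀ τ φ b → ∃ i, τ i = a := fun h => by
    obtain ⟨i, -, hi⟩ := Finset.mem_image.1 h
    exact ⟨i, hi⟩
  ext w
  constructor
  · rintro ⟨s, hs, rfl⟩
    change Fin n → Set.Icc (0 : ℝ) 1 at s
    have hs' : ∀ i, (φ i = some false → (s i : ℝ) = 0) ∧ (φ i = some true → (s i : ℝ) = 1) := hs
    refine ⟨hc.point s, ⟨fun a ha => ?_, fun a ha => ?_⟩, (hc.chart_eq s).symm⟩
    · rcases Finset.mem_union.1 ha with h | h
      · exact (hc.point_mem_box s).1 a h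
      · obtain ⟨i, rfl⟩ := hfix h
        rw [hc.mem_fixed] at h
        rw [point_dir, frameValue]
        by_cases hi : τ i ∈ s₀
        · rw [if_pos hi, (hs' i).1 (by simpa [hi] using h), sub_zero]
        · rw [if_neg hi, (hs' i).2 (by simpa [hi] using h)]
    · by_cases h' : a ∈ (frameTop c hc).1
      · have h : a ∈ fixed s₀ τ φ false := by
          by_contra h
          exact ha (Finset.mem_sdiff.2 ⟨h', h⟩)
        obtain ⟨i, rfl⟩ := hfix h
        rw [hc.mem_fixed] at h
        rw [point_dir, frameValue]
        by_cases hi : τ i ∈ s₀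
        · rw [if_pos hi, (hs' i).2 (by simpa [hi] using h), sub_self]
        · rw [if_neg hi, (hs' i).1 (by simpa [hi] using h)]
      · exact (hc.point_mem_box s).2 a h'
  · rintro ⟨x, ⟨h1, h2⟩, rfl⟩
    obtain ⟨s, rfl, hs⟩ := hc.exists_point_eq (x := x)
      ⟨fun a ha => h1 a (Finset.mem_union_left _ ha), fun a ha => h2 a fun h =>
        ha (Finset.mem_sdiff.1 h).1⟩
    refine ⟨s, fun i => ?_, hc.chart_eq s⟩
    have h3 : φ i = some (xor true (decide (τ i ∈ s₀))) → hc.point s (τ i) = 1 := fun h =>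
      h1 _ (Finset.mem_union_right _ (hc.mem_fixed.2 h))
    have h4 : φ i = some (xor false (decide (τ i ∈ s₀))) → hc.point s (τ i) = 0 := fun h =>
      h2 _ fun h' => (Finset.mem_sdiff.1 h').2 (hc.mem_fixed.2 h)
    have hsi := hs i
    constructor
    · intro hφ
      rw [hsi, frameValue]
      by_cases hi : τ i ∈ s₀
      · rw [if_pos hi, h3 (by simp [hi, hφ]), sub_self]
      · rw [if_neg hi, h4 (by simp [hi, hφ])]
    · intro hφ
      change (s i : ℝ) = 1
      rw [hsi, frameValue]
      by_cases hi : τ i ∈ s₀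
      · rw [if_pos hi, h4 (by simp [hi, hφ]), sub_zero]
      · rw [if_neg hi, h3 (by simp [hi, hφ])]

/-- Every pair of cliques between the smallest and the largest one of a cube determines a face. -/
lemma exists_face (hc : IsFrame c s₀ τ) {A B : Finset W} (hA : bot s₀ τ ⊆ A) (hAB : A ⊆ B)
    (hB : B ⊆ (frameTop c hc).1) :
    ∃ φ : Fin n → Option Bool, (solidCube c).face φ = toRealization '' box H A B := by
  let φ : Fin n → Option Bool := fun i =>
    if τ i ∈ A then some (xor true (decide (τ i ∈ s₀)))
    else if τ i ∈ B then none else some (xor false (decide (τ i ∈ s₀)))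
  have hfix : ∀ {a b}, a ∈ fixed s₀ τ φ b → a ∈ Set.range τ := fun h => by
    obtain ⟨i, -, hi⟩ := Finset.mem_image.1 h
    exact ⟨i, hi⟩
  have htop : ∀ {a}, a ∉ Set.range τ → a ∈ (frameTop c hc).1 → a ∈ bot s₀ τ := by
    intro a ha h
    have ha' : a ∉ Finset.univ.image τ := by simpa using ha
    exact Finset.mem_sdiff.2 ⟨(Finset.mem_union.1 h).resolve_right ha', ha'⟩
  have e1 : bot s₀ τ ∪ fixed s₀ τ φ true = A := by
    ext a
    by_cases ha : a ∈ Set.range τ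
    · obtain ⟨i, rfl⟩ := ha
      rw [Finset.mem_union, hc.mem_fixed, or_iff_right (notMem_bot s₀ τ i)]
      simp only [φ]
      by_cases h1 : τ i ∈ A <;> by_cases h2 : τ i ∈ B <;> simp [h1, h2]
    · rw [Finset.mem_union, or_iff_left fun h => ha (hfix h)]
      exact ⟨fun h => hA h, fun h => htop ha (hB (hAB h))⟩
  have e2 : (frameTop c hc).1 \ fixed s₀ τ φ false = B := by
    ext a
    by_cases ha : a ∈ Set.range τ
    · obtain ⟨i, rfl⟩ := ha
      rw [Finset.mem_sdiff, hc.mem_fixed, and_iff_right (hc.mem_top i)]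
      simp only [φ]
      by_cases h1 : τ i ∈ A
      · simp [h1, hAB h1]
      · by_cases h2 : τ i ∈ B <;> simp [h1, h2]
    · rw [Finset.mem_sdiff, and_iff_left fun h => ha (hfix h)]
      exact ⟨fun h => hAB (hA (htop ha h)), fun h => hB h⟩
  exact ⟨φ, by rw [hc.face_eq, e1, e2]⟩

end IsFrame

/-- The realization of `κ(H)`, for a finite bipartite graph `H`, is a finite rectangular complex. -/
lemma isFiniteRectangularComplex_realizationCells (χ : H.Coloring Bool) [Finite (FiniteClique H)] :
    IsFiniteRectangularComplex (realizationCells (simplexGraph H)) where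
  dim_le := by
    rintro C ⟨n, c, rfl⟩
    obtain ⟨s₀, τ, hc⟩ := exists_isFrame c
    have h1 := (frameTop c hc).card_le_two χ
    have h2 : (Finset.univ.image τ).card ≤ (frameTop c hc).1.card :=
      Finset.card_le_card Finset.subset_union_right
    rw [Finset.card_image_of_injective _ hc.injective, Finset.card_univ, Fintype.card_fin] at h2
    exact h2.trans h1
  injective := by
    rintro C ⟨n, c, rfl⟩ s t h
    change Fin n → Set.Icc (0 : ℝ) 1 at s t
    obtain ⟨s₀, τ, hc⟩ := exists_isFrame c
    have h1 := toRealization_injective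
      (((hc.chart_eq s).symm.trans h).trans (hc.chart_eq t))
    funext (i : Fin n)
    have h2 : hc.point s (τ i) = hc.point t (τ i) := by rw [h1]
    rw [IsFrame.point_dir, IsFrame.point_dir] at h2
    have h3 := congrArg (frameValue s₀ (τ i)) h2
    rw [frameValue_frameValue, frameValue_frameValue] at h3
    exact Subtype.ext h3
  finite := by
    refine (Set.finite_range fun p : FiniteClique H × FiniteClique H =>
      (toRealization '' box H p.1.1 p.2.1 : Set (Realization (simplexGraph H)))).subset ?_
    rintro _ ⟨C, ⟨n, c, rfl⟩, rfl⟩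
    obtain ⟨s₀, τ, hc⟩ := exists_isFrame c
    exact ⟨((frameTop c hc).ofSubset (IsFrame.bot s₀ τ)
      (Finset.sdiff_subset.trans Finset.subset_union_left), frameTop c hc), hc.carrier_eq.symm⟩
  cover := by
    intro w
    obtain ⟨x, rfl⟩ := toRealization_surjective w
    obtain ⟨C, hC, h⟩ := exists_cell ∅ x.supp (Finset.empty_subset _)
    exact ⟨C, hC, h ▸ ⟨x, ⟨by simp, fun a => apply_eq_zero⟩, rfl⟩⟩
  face_mem := by
    rintro C ⟨n, c, rfl⟩ φ
    change Fin n → Option Bool at φ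
    obtain ⟨s₀, τ, hc⟩ := exists_isFrame c
    obtain ⟨D, hD, h⟩ := exists_cell (H := H) (IsFrame.bot s₀ τ ∪ IsFrame.fixed s₀ τ φ true)
      ((frameTop c hc).ofSubset ((frameTop c hc).1 \ IsFrame.fixed s₀ τ φ false)
        Finset.sdiff_subset) (by
        intro a ha
        rw [FiniteClique.coe_ofSubset, Finset.mem_sdiff]
        rcases Finset.mem_union.1 ha with h | h
        · refine ⟨Finset.mem_union_left _ (Finset.mem_sdiff.1 h).1, fun h' => ?_⟩
          obtain ⟨i, -, rfl⟩ := Finset.mem_image.1 h'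
          exact IsFrame.notMem_bot s₀ τ i h
        · obtain ⟨i, -, rfl⟩ := Finset.mem_image.1 h
          refine ⟨hc.mem_top i, fun h' => ?_⟩
          rw [hc.mem_fixed] at h h'
          rw [h] at h'
          simp at h')
    exact ⟨D, hD, h.trans (hc.face_eq φ).symm⟩
  inter := by
    rintro C ⟨n, c, rfl⟩ D ⟨m, d, rfl⟩ hne
    obtain ⟨s₀, τ, hc⟩ := exists_isFrame c
    obtain ⟨t₀, υ, hd⟩ := exists_isFrame d
    have key : (solidCube c).carrier ∩ (solidCube d).carrier = toRealization ''
        box H (IsFrame.bot s₀ τ ∪ IsFrame.bot t₀ υ) ((frameTop c hc).1 ∩ (frameTop d hd).1) := by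
      rw [hc.carrier_eq, hd.carrier_eq, ← Set.image_inter toRealization_injective, box_inter_box]
    rw [key] at hne ⊢
    have hsub := subset_of_box_nonempty hne.of_image
    obtain ⟨φ, hφ⟩ := hc.exists_face Finset.subset_union_left hsub Finset.inter_subset_left
    obtain ⟨ψ, hψ⟩ := hd.exists_face Finset.subset_union_right hsub Finset.inter_subset_right
    exact ⟨φ, ψ, hφ, hψ⟩
  compatible := by
    rintro C ⟨n, c, rfl⟩ D ⟨m, d, rfl⟩ x hx y hy
    obtain ⟨s₀, τ, hc⟩ := exists_isFrame c
    obtain ⟨t₀, υ, hd⟩ := exists_isFrame d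
    obtain ⟨x, rfl⟩ := toRealization_surjective x
    obtain ⟨y, rfl⟩ := toRealization_surjective y
    rw [hc.localEDist_eq hx.1 hy.1, hd.localEDist_eq hx.2 hy.2]
  edist_eq _ _ := rfl

end RectangularComplex

/-! ### Isometries of the realization -/

section Isometries

open scoped Classical

variable {W : Type u} {H : SimpleGraph W}

namespace CliqueSpace

/-- The image of a point under an automorphism of `H`. -/
noncomputable def map (σ : H ≃g H) (x : CliqueSpace H) : CliqueSpace H :=
  ofFun (x.supp.map σ) (fun a => x (σ.symm a)) (fun _ => x.mem_Icc _) fun _ ha =>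
    apply_eq_zero fun h => ha (FiniteClique.mem_map.2 h)

lemma map_apply (σ : H ≃g H) (x : CliqueSpace H) (a : W) : x.map σ a = x (σ.symm a) := rfl

lemma dist_map (σ : H ≃g H) (x y : CliqueSpace H) : dist (x.map σ) (y.map σ) = dist x y := by
  have hs : ∀ z : CliqueSpace H, (z.map σ).supp.1 = z.supp.1.map σ.toEquiv.toEmbedding := by
    intro z
    ext a
    rw [Finset.mem_map_equiv, mem_supp, mem_supp]
    rfl
  change ∑ a ∈ (x.map σ).supp.1 ∪ (y.map σ).supp.1, _ = ∑ a ∈ x.supp.1 ∪ y.supp.1, _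
  rw [hs, hs, ← Finset.map_union, Finset.sum_map]
  refine Finset.sum_congr rfl fun a _ => ?_
  simp [map_apply]

/-- The action of the automorphisms of `H` on the model by isometries. -/
noncomputable def isometryAction (H : SimpleGraph W) :
    (H ≃g H) →* (CliqueSpace H ≃ᵢ CliqueSpace H) where
  toFun σ :=
    { toFun := map σ
      invFun := map σ.symm
      left_inv := fun x => by ext a; simp [map_apply]
      right_inv := fun x => by ext a; simp [map_apply]
      isometry_toFun := Isometry.of_dist_eq (dist_map σ) }
  map_one' := by ext x a; rfl
  map_mul' _ _ := by ext x a; rfl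

lemma isometryAction_apply (σ : H ≃g H) (x : CliqueSpace H) : isometryAction H σ x = x.map σ := rfl

lemma supp_vertex (a : W) : (vertex H a).supp.1 = {a} := by
  ext b
  simp [mem_supp, vertex_apply]

lemma norm_vertex (a : W) : (vertex H a).norm = 1 := by
  simp [norm, supp_vertex, vertex_apply]

lemma vertex_injective : Function.Injective (vertex H) := fun a b h => by
  have : (vertex H a).supp.1 = (vertex H b).supp.1 := by rw [h]
  simpa [supp_vertex] using this

lemma supp_corner {a b : W} (h : H.Adj a b) : (corner h).supp.1 = {a, b} := by
  ext c
  rw [mem_supp, corner_apply]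
  split_ifs with hc <;> simpa using hc

lemma norm_corner {a b : W} (h : H.Adj a b) : (corner h).norm = 2 := by
  rw [norm, supp_corner, Finset.sum_pair h.ne]
  norm_num [corner_apply]

/-- A point is determined by its distances from the vertices. -/
lemma dist_vertex (x : CliqueSpace H) (a : W) : dist x (vertex H a) = x.norm + 1 - 2 * x a := by
  have h1 : x.supp.1 ⊆ insert a x.supp.1 := Finset.subset_insert _ _
  rw [dist_eq_sum h1 (by simp [supp_vertex]), norm_eq_sum h1,
    ← Finset.add_sum_erase _ _ (Finset.mem_insert_self a _),
    ← Finset.add_sum_erase _ (fun b => x b) (Finset.mem_insert_self a _)]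
  have h2 : ∀ b ∈ (insert a x.supp.1).erase a, |x b - vertex H a b| = x b := fun b hb => by
    rw [vertex_apply, if_neg (Finset.ne_of_mem_erase hb), sub_zero, abs_of_nonneg (x.nonneg b)]
  rw [Finset.sum_congr rfl h2, vertex_apply, if_pos rfl, abs_sub_comm,
    abs_of_nonneg (sub_nonneg.2 (x.le_one a))]
  ring

lemma exists_eq_corner (χ : H.Coloring Bool) {x : CliqueSpace H} (hx : x.norm = 2) :
    ∃ (a b : W) (h : H.Adj a b), x = corner h := by
  have hle : x.norm ≤ x.supp.1.card := by
    refine (Finset.sum_le_card_nsmul _ _ 1 fun a _ => x.le_one a).trans (by simp)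
  have hcard : x.supp.1.card = 2 := by
    refine le_antisymm (FiniteClique.card_le_two χ x.supp) ?_
    rw [hx] at hle
    exact_mod_cast hle
  obtain ⟨a, b, hab, hs⟩ := Finset.card_eq_two.1 hcard
  have h : H.Adj a b := x.supp.2 (by simp [hs]) (by simp [hs]) hab
  refine ⟨a, b, h, ?_⟩
  rw [norm, hs, Finset.sum_pair hab] at hx
  have ha := x.le_one a
  have hb := x.le_one b
  ext c
  rw [corner_apply]
  split_ifs with hc
  · rcases hc with rfl | rfl <;> linarith
  · exact apply_eq_zero (by simpa [hs] using hc)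

lemma dist_corner_of_le {x : CliqueSpace H} {a b : W} (h : H.Adj a b)
    (hx : x.supp.1 ⊆ {a, b}) : dist x (corner h) = 2 - x.norm := by
  rw [← norm_corner h]
  refine dist_eq_norm_sub_norm fun c => ?_
  by_cases hc : c ∈ x.supp.1
  · have := hx hc
    rw [corner_apply, if_pos (by simpa using this)]
    exact x.le_one c
  · rw [apply_eq_zero hc]
    exact (corner h).nonneg c

/-- `0` is the only point that has distance at most `2` from all points. -/
lemma eq_zero_of_forall_dist_le (χ : H.Coloring Bool) (h3 : HasThreeDisjointEdges H)
    {x : CliqueSpace H} (hx : ∀ y, dist x y ≤ 2) : x = zero H := by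
  obtain ⟨a, b, hab, ha, hb⟩ := FiniteClique.exists_disjoint_edge χ h3 x.supp
  have h1 := hx (corner hab)
  have hd : Disjoint x.supp.1 {a, b} := by
    rw [Finset.disjoint_right]
    intro c hc
    simp only [Finset.mem_insert, Finset.mem_singleton] at hc
    rcases hc with rfl | rfl <;> assumption
  have e1 : ∀ c ∈ x.supp.1, |x c - corner hab c| = x c := fun c hc => by
    have : ¬ (c = a ∨ c = b) := by simpa using Finset.disjoint_left.1 hd hc
    rw [corner_apply, if_neg this, sub_zero, abs_of_nonneg (x.nonneg c)]
  have e2 : ∀ c ∈ ({a, b} : Finset W), |x c - corner hab c| = corner hab c := fun c hc => by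
    rw [apply_eq_zero (Finset.disjoint_right.1 hd hc), zero_sub, abs_neg,
      abs_of_nonneg ((corner hab).nonneg c)]
  rw [dist_eq_sum (S := x.supp.1 ∪ {a, b}) Finset.subset_union_left
    ((supp_corner hab).subset.trans Finset.subset_union_right), Finset.sum_union hd,
    Finset.sum_congr rfl e1, Finset.sum_congr rfl e2, ← supp_corner hab] at h1
  change x.norm + (corner hab).norm ≤ 2 at h1
  rw [norm_corner] at h1
  have h0 : dist x (zero H) = 0 := by
    rw [dist_zero_right]
    exact le_antisymm (by linarith) x.norm_nonneg
  exact dist_eq_zero.1 h0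

lemma dist_zero_le_two (χ : H.Coloring Bool) (y : CliqueSpace H) : dist (zero H) y ≤ 2 := by
  rw [dist_comm, dist_zero_right]
  have h1 : y.norm ≤ y.supp.1.card :=
    (Finset.sum_le_card_nsmul _ _ 1 fun a _ => y.le_one a).trans (by simp)
  have h2 : (y.supp.1.card : ℝ) ≤ 2 := by exact_mod_cast FiniteClique.card_le_two χ y.supp
  linarith

/-- Among the points of norm `1`, the vertices are those that are at distance `1` from two distinct
points of norm `2`: such a point lies below two corners, hence is supported by a common end of
two edges. -/
lemma exists_eq_vertex (χ : H.Coloring Bool) {x y z : CliqueSpace H} (hx : x.norm = 1)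
    (hy : y.norm = 2) (hz : z.norm = 2) (hyz : y ≠ z) (hxy : dist x y = 1) (hxz : dist x z = 1) :
    ∃ a, x = vertex H a := by
  have key : ∀ {y : CliqueSpace H}, y.norm = 2 → dist x y = 1 → x.supp.1 ⊆ y.supp.1 := by
    intro y hy hxy a ha
    have := le_of_dist_eq (x := x) (y := y) (by rw [hxy, hx, hy]; norm_num) a
    rw [mem_supp] at ha ⊢
    have h0 := lt_of_le_of_ne (x.nonneg a) ha.symm
    linarith
  have h1 := key hy hxy
  have h2 := key hz hxz
  obtain ⟨a, b, hab, rfl⟩ := exists_eq_corner χ hy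
  obtain ⟨c, d, hcd, rfl⟩ := exists_eq_corner χ hz
  rw [supp_corner] at h1 h2
  have hcard : x.supp.1.card ≤ 1 := by
    by_contra hlt
    have e1 : x.supp.1 = {a, b} := Finset.eq_of_subset_of_card_le h1
      (by rw [Finset.card_pair hab.ne]; omega)
    have e2 : x.supp.1 = {c, d} := Finset.eq_of_subset_of_card_le h2
      (by rw [Finset.card_pair hcd.ne]; omega)
    refine hyz ?_
    ext e
    have : e ∈ ({a, b} : Finset W) ↔ e ∈ ({c, d} : Finset W) := by rw [← e1, ← e2]
    simp only [Finset.mem_insert, Finset.mem_singleton] at this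
    rw [corner_apply, corner_apply]
    simp [this]
  have hne : x.supp.1.Nonempty := by
    rw [Finset.nonempty_iff_ne_empty]
    intro h
    rw [norm, h, Finset.sum_empty] at hx
    norm_num at hx
  obtain ⟨e, he⟩ := Finset.card_eq_one.1 (le_antisymm hcard hne.card_pos)
  rw [norm, he, Finset.sum_singleton] at hx
  refine ⟨e, ?_⟩
  ext f
  rw [vertex_apply]
  split_ifs with hf
  · rw [hf, hx]
  · exact apply_eq_zero (by simpa [he] using hf)

/-- Every isometry of the model is induced by an automorphism of `H`: it fixes `0`, permutes the
vertices, and is determined by its action on them. -/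
lemma isometryAction_bijective (χ : H.Coloring Bool) (h3 : HasThreeDisjointEdges H)
    (h2 : ∀ a, ∃ b c, b ≠ c ∧ H.Adj a b ∧ H.Adj a c) :
    Function.Bijective (isometryAction H) := by
  constructor
  · intro σ τ h
    ext a
    have h1 : (vertex H a).map σ (σ a) = (vertex H a).map τ (σ a) :=
      congrArg (fun z : CliqueSpace H => z (σ a)) (DFunLike.congr_fun h (vertex H a))
    rw [map_apply, map_apply, RelIso.symm_apply_apply, vertex_apply, vertex_apply, if_pos rfl] at h1
    by_contra hne
    rw [if_neg fun h => hne ((RelIso.symm_apply_eq τ).1 h)] at h1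
    norm_num at h1
  · intro φ
    have hzero : ∀ φ : CliqueSpace H ≃ᵢ CliqueSpace H, φ (zero H) = zero H := by
      intro φ
      refine eq_zero_of_forall_dist_le χ h3 fun y => ?_
      rw [← φ.apply_symm_apply y, φ.dist_eq]
      exact dist_zero_le_two χ _
    have hnorm : ∀ (φ : CliqueSpace H ≃ᵢ CliqueSpace H) x, (φ x).norm = x.norm := by
      intro φ x
      rw [← dist_zero_right, ← dist_zero_right]
      nth_rewrite 1 [← hzero φ]
      exact φ.dist_eq _ _
    have hvertex : ∀ (φ : CliqueSpace H ≃ᵢ CliqueSpace H) a, ∃ b, φ (vertex H a) = vertex H b := by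
      intro φ a
      obtain ⟨b, c, hbc, hb, hc⟩ := h2 a
      have hd : ∀ {b} (h : H.Adj a b), dist (vertex H a) (corner h) = 1 := fun h => by
        rw [dist_corner_of_le h (by simp [supp_vertex]), norm_vertex]
        norm_num
      refine exists_eq_vertex χ (y := φ (corner hb)) (z := φ (corner hc)) ?_ ?_ ?_ ?_ ?_ ?_
      · rw [hnorm, norm_vertex]
      · rw [hnorm, norm_corner]
      · rw [hnorm, norm_corner]
      · intro h
        have h' : (corner hb).supp.1 = (corner hc).supp.1 := by rw [φ.injective h]
        rw [supp_corner, supp_corner] at h'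
        have : b ∈ ({a, c} : Finset W) := by rw [← h']; simp
        simp only [Finset.mem_insert, Finset.mem_singleton] at this
        exact this.elim (fun h => hb.ne h.symm) hbc
      · rw [φ.dist_eq, hd]
      · rw [φ.dist_eq, hd]
    choose f hf using hvertex
    have hinv : ∀ φ a, f φ.symm (f φ a) = a := by
      intro φ a
      apply vertex_injective (H := H)
      rw [← hf, ← hf, IsometryEquiv.symm_apply_apply]
    have hinv' : ∀ φ a, f φ (f φ.symm a) = a := by
      intro φ a
      apply vertex_injective (H := H)
      rw [← hf, ← hf, IsometryEquiv.apply_symm_apply]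
    -- The coordinates are determined by the distances from the vertices.
    have hcoord : ∀ (φ : CliqueSpace H ≃ᵢ CliqueSpace H) x a, φ x (f φ a) = x a := by
      intro φ x a
      have e1 := dist_vertex (φ x) (f φ a)
      rw [← hf, φ.dist_eq, hnorm, dist_vertex] at e1
      linarith
    have hadj : ∀ (φ : CliqueSpace H ≃ᵢ CliqueSpace H) {a b : W}, H.Adj a b →
        H.Adj (f φ a) (f φ b) := by
      intro φ a b h
      refine (φ (corner h)).supp.2 (mem_supp.2 ?_) (mem_supp.2 ?_) fun heq => ?_
      · rw [hcoord, corner_apply]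
        simp
      · rw [hcoord, corner_apply]
        simp
      · exact h.ne (by rw [← hinv φ a, heq, hinv])
    refine ⟨⟨⟨f φ, f φ.symm, hinv φ, hinv' φ⟩, fun {a b} => ⟨fun h => ?_, hadj φ⟩⟩, ?_⟩
    · have := hadj φ.symm h
      simpa [hinv] using this
    · ext x a
      rw [isometryAction_apply, map_apply]
      change x (f φ.symm a) = _
      rw [← hcoord φ, hinv']

end CliqueSpace

/-- Conjugation by an isometry. -/
def isometryEquivConj {X Y : Type u} [PseudoEMetricSpace X] [PseudoEMetricSpace Y] (e : X ≃ᵢ Y) :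
    (X ≃ᵢ X) ≃* (Y ≃ᵢ Y) where
  toFun f := (e.symm.trans f).trans e
  invFun f := (e.trans f).trans e.symm
  left_inv f := by ext x; simp
  right_inv f := by ext x; simp
  map_mul' f g := by ext x; simp

/-- The isometry group of the realization of `κ(H)` is `Aut(κ(H))`. -/
noncomputable def simplexGraphAutEquivIsometry (χ : H.Coloring Bool)
    (h3 : HasThreeDisjointEdges H) (h2 : ∀ a, ∃ b c, b ≠ c ∧ H.Adj a b ∧ H.Adj a c) :
    (simplexGraph H ≃g simplexGraph H) ≃*
      (Realization (simplexGraph H) ≃ᵢ Realization (simplexGraph H)) :=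
  ((simplexGraphAutEquiv χ h3).symm.trans
    (MulEquiv.ofBijective _ (CliqueSpace.isometryAction_bijective χ h3 h2))).trans
      (isometryEquivConj (CliqueSpace.isometryEquivRealization H))

end Isometries

/-! ### Star dendrons -/

/-- An arc that contains another arc with the same ends is equal to it. -/
lemma range_subset_range_of_isEmbedding {D : Type u} [TopologicalSpace D] {γ δ : unitInterval → D}
    (hγ : Continuous γ) (hδ : Topology.IsEmbedding δ) (h0 : γ 0 = δ 0) (h1 : γ 1 = δ 1)
    (h : Set.range γ ⊆ Set.range δ) : Set.range δ ⊆ Set.range γ := by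
  have hc : IsPreconnected (δ ⁻¹' Set.range γ) := by
    rw [← hδ.isInducing.isPreconnected_image, Set.image_preimage_eq_of_subset h]
    exact isPreconnected_range hγ
  rintro _ ⟨t, rfl⟩
  exact hc.Icc_subset (a := 0) (b := 1) ⟨0, h0⟩ ⟨1, h1⟩ ⟨t.2.1, t.2.2⟩

section StarDendron

open scoped Classical

open CliqueSpace

variable {W : Type u}

/-- The star with an arm of length `1` for every element of `W`, centred at `0`. -/
abbrev StarSpace (W : Type u) : Type u := CliqueSpace (⊥ : SimpleGraph W)

namespace StarSpace

lemma apply_eq_zero_of_ne {x : StarSpace W} {a b : W} (ha : x a ≠ 0) (hab : b ≠ a) : x b = 0 := by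
  by_contra hb
  exact x.supp.2 (mem_supp.2 hb) (mem_supp.2 ha) hab

lemma norm_eq_apply {x : StarSpace W} {a : W} (h : ∀ b, b ≠ a → x b = 0) : x.norm = x a := by
  rw [CliqueSpace.norm_eq_sum (S := {a}), Finset.sum_singleton]
  intro b hb
  rw [mem_supp] at hb
  by_contra hba
  exact hb (h b (by simpa using hba))

lemma exists_arm [Nonempty W] (x : StarSpace W) : ∃ a, ∀ b, b ≠ a → x b = 0 := by
  by_cases h : ∃ a, x a ≠ 0
  · obtain ⟨a, ha⟩ := h
    exact ⟨a, fun b hb => apply_eq_zero_of_ne ha hb⟩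
  · push Not at h
    exact ⟨Classical.arbitrary W, fun b _ => h b⟩

lemma eq_of_apply_eq {x y : StarSpace W} {b : W} (hx : x b ≠ 0) (h : x b = y b) : x = y := by
  ext c
  by_cases hc : c = b
  · rw [hc, h]
  · rw [apply_eq_zero_of_ne hx hc, apply_eq_zero_of_ne (h ▸ hx) hc]

/-- The coordinate on the arm `b`, extended to the other arms by minus the distance from `0`. -/
noncomputable def height (b : W) (x : StarSpace W) : ℝ := 2 * x b - x.norm

lemma continuous_height (b : W) : Continuous (height b) := by
  unfold height
  have h1 := CliqueSpace.continuous_apply (H := (⊥ : SimpleGraph W)) b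
  have h2 := CliqueSpace.continuous_norm (H := (⊥ : SimpleGraph W))
  fun_prop

/-- On the set where it is nonnegative the height is one-to-one. -/
lemma eq_of_height_eq {b : W} {x y : StarSpace W} (hx : 0 ≤ height b x)
    (h : height b x = height b y) : x = y := by
  have key : ∀ z : StarSpace W, 0 ≤ height b z → z b = height b z ∧ ∀ c, c ≠ b → z c = 0 := by
    intro z hz
    by_cases hb : z b = 0
    · unfold height at hz ⊢
      rw [hb] at hz ⊢
      have h0 := z.norm_nonneg
      refine ⟨by linarith, fun c _ => ?_⟩
      exact le_antisymm ((z.apply_le_norm c).trans (by linarith)) (z.nonneg c)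
    · have hc : ∀ c, c ≠ b → z c = 0 := fun c hc => apply_eq_zero_of_ne hb hc
      refine ⟨?_, hc⟩
      rw [height, norm_eq_apply hc]
      ring
  obtain ⟨h1, h2⟩ := key x hx
  obtain ⟨h3, h4⟩ := key y (h ▸ hx)
  ext c
  by_cases hc : c = b
  · rw [hc, h1, h3, h]
  · rw [h2 c hc, h4 c hc]

/-- The isometric segment of length `2` formed by the arms `a` (negative parameters) and `b`. -/
noncomputable def line (a b : W) (r : Set.Icc (-1 : ℝ) 1) : StarSpace W :=
  if h : 0 ≤ (r : ℝ) then CliqueSpace.single ⊥ b r (Set.mem_Icc.2 ⟨h, r.2.2⟩)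
  else CliqueSpace.single ⊥ a (-r) (Set.mem_Icc.2 ⟨by linarith, by linarith [r.2.1]⟩)

variable {a b : W}

lemma line_apply_left (hab : a ≠ b) (r : Set.Icc (-1 : ℝ) 1) :
    line a b r a = max (-(r : ℝ)) 0 := by
  unfold line
  split_ifs with h
  · rw [single_apply, if_neg hab, max_eq_right (by linarith)]
  · rw [single_apply, if_pos rfl, max_eq_left (by linarith)]

lemma line_apply_right (hab : a ≠ b) (r : Set.Icc (-1 : ℝ) 1) :
    line a b r b = max (r : ℝ) 0 := by
  unfold line
  split_ifs with h
  · rw [single_apply, if_pos rfl, max_eq_left h]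
  · rw [single_apply, if_neg hab.symm, max_eq_right (by linarith)]

lemma line_apply_of_ne {c : W} (ha : c ≠ a) (hb : c ≠ b) (r : Set.Icc (-1 : ℝ) 1) :
    line a b r c = 0 := by
  unfold line
  split_ifs with h
  · rw [single_apply, if_neg hb]
  · rw [single_apply, if_neg ha]

lemma supp_line_subset (r : Set.Icc (-1 : ℝ) 1) : (line a b r).supp.1 ⊆ {a, b} := by
  intro c hc
  rw [mem_supp] at hc
  by_contra h
  simp only [Finset.mem_insert, Finset.mem_singleton, not_or] at h
  exact hc (line_apply_of_ne h.1 h.2 r)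

lemma abs_max_neg_sub_add_abs_max_sub (r s : ℝ) :
    |max (-r) 0 - max (-s) 0| + |max r 0 - max s 0| = |r - s| := by
  rcases le_total 0 r with hr | hr <;> rcases le_total 0 s with hs | hs
  · simp [hr, hs]
  · rw [max_eq_right (by linarith), max_eq_left (by linarith : 0 ≤ -s), max_eq_left hr,
      max_eq_right hs, abs_of_nonneg (by linarith : 0 ≤ r - s),
      abs_of_nonpos (by linarith : 0 - -s ≤ 0), abs_of_nonneg (by linarith : 0 ≤ r - 0)]
    ring
  · rw [max_eq_left (by linarith : 0 ≤ -r), max_eq_right (by linarith : -s ≤ 0), max_eq_right hr,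
      max_eq_left hs, abs_of_nonpos (by linarith : r - s ≤ 0),
      abs_of_nonneg (by linarith : 0 ≤ -r - 0), abs_of_nonpos (by linarith : 0 - s ≤ 0)]
    ring
  · rw [max_eq_left (by linarith : 0 ≤ -r), max_eq_left (by linarith : 0 ≤ -s), max_eq_right hr,
      max_eq_right hs, sub_self, abs_zero, add_zero, abs_sub_comm]
    congr 1
    ring

lemma isometry_line (hab : a ≠ b) : Isometry (line a b) := by
  refine Isometry.of_dist_eq fun r s => ?_
  rw [dist_eq_sum (supp_line_subset r) (supp_line_subset s), Finset.sum_pair hab,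
    line_apply_left hab, line_apply_left hab, line_apply_right hab, line_apply_right hab,
    abs_max_neg_sub_add_abs_max_sub]
  rfl

lemma norm_line (hab : a ≠ b) (r : Set.Icc (-1 : ℝ) 1) :
    (line a b r).norm = max (-(r : ℝ)) 0 + max (r : ℝ) 0 := by
  rw [CliqueSpace.norm_eq_sum (supp_line_subset r), Finset.sum_pair hab, line_apply_left hab,
    line_apply_right hab]

lemma max_sub_max_neg (r : ℝ) : max r 0 - max (-r) 0 = r := by
  rcases le_total 0 r with h | h
  · simp [h]
  · simp [h]

lemma height_line_right (hab : a ≠ b) (r : Set.Icc (-1 : ℝ) 1) : height b (line a b r) = r := by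
  rw [height, norm_line hab, line_apply_right hab]
  linarith [max_sub_max_neg (r : ℝ)]

lemma height_line_left (hab : a ≠ b) (r : Set.Icc (-1 : ℝ) 1) : height a (line a b r) = -r := by
  rw [height, norm_line hab, line_apply_left hab]
  linarith [max_sub_max_neg (r : ℝ)]

lemma exists_line_right (hab : a ≠ b) {x : StarSpace W} (h : ∀ c, c ≠ b → x c = 0) :
    ∃ r, line a b r = x := by
  refine ⟨⟨x b, by linarith [x.nonneg b], x.le_one b⟩, ?_⟩
  ext c
  by_cases hc : c = b
  · rw [hc, line_apply_right hab, max_eq_left (x.nonneg b)]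
  by_cases hc' : c = a
  · rw [hc', line_apply_left hab, h a hab, max_eq_right (by linarith [x.nonneg b])]
  · rw [line_apply_of_ne hc' hc, h c hc]

lemma exists_line_left (hab : a ≠ b) {x : StarSpace W} (h : ∀ c, c ≠ a → x c = 0) :
    ∃ r, line a b r = x := by
  refine ⟨⟨-(x a), by linarith [x.le_one a], by linarith [x.nonneg a]⟩, ?_⟩
  ext c
  by_cases hc : c = a
  · rw [hc, line_apply_left hab, neg_neg, max_eq_left (x.nonneg a)]
  by_cases hc' : c = b
  · rw [hc', line_apply_right hab, h b hab.symm, max_eq_right (by linarith [x.nonneg a])]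
  · rw [line_apply_of_ne hc hc', h c hc]

/-- Any two points of a star lie on the union of two arms. -/
lemma exists_line [Nontrivial W] (x y : StarSpace W) :
    ∃ (a b : W) (_ : a ≠ b) (r s : Set.Icc (-1 : ℝ) 1), line a b r = x ∧ line a b s = y := by
  obtain ⟨a, ha⟩ := exists_arm x
  obtain ⟨b, hb⟩ := exists_arm y
  by_cases hab : a = b
  · subst hab
    obtain ⟨c, hc⟩ := exists_ne a
    obtain ⟨r, hr⟩ := exists_line_right hc ha
    obtain ⟨s, hs⟩ := exists_line_right hc hb
    exact ⟨c, a, hc, r, s, hr, hs⟩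
  · obtain ⟨r, hr⟩ := exists_line_left hab ha
    obtain ⟨s, hs⟩ := exists_line_right hab hb
    exact ⟨a, b, hab, r, s, hr, hs⟩

/-- A point of nonnegative height separates the points below it from those above it. -/
lemma not_joinedIn_of_height_lt {x y p : StarSpace W} (h0 : 0 ≤ height b p)
    (hx : height b x ≤ height b p) (hy : height b p ≤ height b y) : ¬ JoinedIn {p}ᶜ x y := by
  rintro ⟨γ, hγ⟩
  obtain ⟨t, ht⟩ := mem_range_of_exists_le_of_exists_ge
    ((continuous_height b).comp γ.continuous) ⟨0, by simpa using hx⟩ ⟨1, by simpa using hy⟩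
  exact hγ t (eq_of_height_eq h0 ht.symm).symm

/-- Each point of `line a b` separates the two parts of the line: on the arm `b` by the height of
`b`, on the arm `a` by the height of `a`. -/
lemma not_joinedIn_line (hab : a ≠ b) {r s t : Set.Icc (-1 : ℝ) 1} (hrt : r ≤ t) (hts : t ≤ s) :
    ¬ JoinedIn {line a b t}ᶜ (line a b r) (line a b s) := by
  rcases le_total 0 (t : ℝ) with h | h
  · refine not_joinedIn_of_height_lt (b := b) ?_ ?_ ?_ <;>
      simp only [height_line_right hab] <;> assumption
  · refine fun hj => not_joinedIn_of_height_lt (b := a) ?_ ?_ ?_ hj.symm <;>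
      simp only [height_line_left hab, Subtype.coe_le_coe, neg_le_neg_iff, Left.nonneg_neg_iff] <;>
      assumption

/-- The point of parameter `t` of the segment from `r` to `s`. -/
noncomputable def between (r s : Set.Icc (-1 : ℝ) 1) (t : unitInterval) : Set.Icc (-1 : ℝ) 1 :=
  ⟨(1 - (t : ℝ)) * r + t * s, by
    have h0 := t.2.1
    have h1 := t.2.2
    have hr0 := r.2.1
    have hr1 := r.2.2
    have hs0 := s.2.1
    have hs1 := s.2.2
    constructor <;> nlinarith⟩

lemma continuous_between (r s : Set.Icc (-1 : ℝ) 1) : Continuous (between r s) := by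
  unfold between
  fun_prop

lemma between_injective {r s : Set.Icc (-1 : ℝ) 1} (hrs : r ≠ s) :
    Function.Injective (between r s) := by
  intro t t' h
  have h1 : (1 - (t : ℝ)) * r + t * s = (1 - (t' : ℝ)) * r + t' * s := congrArg Subtype.val h
  have h2 : ((t : ℝ) - t') * (s - r) = 0 := by linear_combination h1
  rcases mul_eq_zero.1 h2 with h | h
  · exact Subtype.ext (by linarith)
  · exact absurd (Subtype.ext (by linarith)) hrs

lemma between_mem (r s : Set.Icc (-1 : ℝ) 1) (t : unitInterval) :
    (r ≤ between r s t ∧ between r s t ≤ s) ∨ (s ≤ between r s t ∧ between r s t ≤ r) := by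
  have h0 := t.2.1
  have h1 := t.2.2
  simp only [← Subtype.coe_le_coe, between]
  rcases le_total (r : ℝ) s with h | h
  · left; constructor <;> nlinarith
  · right; constructor <;> nlinarith

lemma isDendron_and_compactSpace [Finite W] [Nontrivial W] :
    IsDendron (StarSpace W) ∧ CompactSpace (StarSpace W) := by
  have hcompact : CompactSpace (StarSpace W) := by
    have harm : ∀ b : W, (CliqueSpace.vertex (⊥ : SimpleGraph W) b).supp.1 ⊆
        (FiniteClique.single ⊥ b).1 := fun b => (supp_vertex b).subset
    have h : (Set.univ : Set (StarSpace W)) = ⋃ b : W, Set.range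
        (lineMap (FiniteClique.single ⊥ b) (zero ⊥) (CliqueSpace.vertex ⊥ b)
          (supp_zero_subset _) (harm b)) := by
      refine (Set.eq_univ_of_forall fun x => ?_).symm
      obtain ⟨b, hb⟩ := exists_arm x
      refine Set.mem_iUnion.2 ⟨b, ⟨x b, x.mem_Icc b⟩, ?_⟩
      ext c
      rw [lineMap_apply, zero_apply, vertex_apply]
      split_ifs with hc
      · simp [hc]
      · simp [hb c hc]
    exact ⟨h ▸ isCompact_iUnion fun b => isCompact_range (continuous_lineMap _ _ _ _ _)⟩
  refine ⟨⟨inferInstance, fun x y hxy => ?_, fun x y hxy => ?_⟩, hcompact⟩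
  · obtain ⟨a, b, hab, r, s, rfl, rfl⟩ := exists_line x y
    have hrs : r ≠ s := fun h => hxy (by rw [h])
    have hmid : ((r : ℝ) + s) / 2 ∈ Set.Icc (-1 : ℝ) 1 :=
      ⟨by linarith [r.2.1, s.2.1], by linarith [r.2.2, s.2.2]⟩
    have hne : (r : ℝ) ≠ s := fun h => hrs (Subtype.ext h)
    refine ⟨line a b ⟨_, hmid⟩, fun h => ?_, fun h => ?_, ?_⟩
    · have := congrArg Subtype.val ((isometry_line hab).injective h)
      simp only at this
      exact hne (by linarith)
    · have := congrArg Subtype.val ((isometry_line hab).injective h)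
      simp only at this
      exact hne (by linarith)
    · rw [(isometry_line hab).dist_eq, (isometry_line hab).dist_eq, (isometry_line hab).dist_eq,
        Subtype.dist_eq, Subtype.dist_eq, Subtype.dist_eq, Real.dist_eq, Real.dist_eq, Real.dist_eq]
      have e1 : (r : ℝ) - (r + s) / 2 = (r - s) / 2 := by ring
      have e2 : ((r : ℝ) + s) / 2 - s = (r - s) / 2 := by ring
      simp only [e1, e2]
      rw [abs_div, abs_two]
      ring
  · obtain ⟨a, b, hab, r, s, rfl, rfl⟩ := exists_line x y
    have hrs : r ≠ s := fun h => hxy (by rw [h])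
    let γ : unitInterval → StarSpace W := fun t => line a b (between r s t)
    have hγ : Continuous γ := (isometry_line hab).continuous.comp (continuous_between r s)
    have hγi : Function.Injective γ := (isometry_line hab).injective.comp (between_injective hrs)
    have h0 : γ 0 = line a b r := congrArg (line a b) (Subtype.ext (by simp [between]))
    have h1 : γ 1 = line a b s := congrArg (line a b) (Subtype.ext (by simp [between]))
    refine ⟨Set.range γ, ⟨γ, (hγ.isClosedEmbedding hγi).isEmbedding, h0, h1, rfl⟩, ?_⟩
    rintro A ⟨δ, hδ, d0, d1, rfl⟩
    -- An arc from `x` to `y` cannot avoid a point of the segment, since this point separates them.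
    have hsub : Set.range γ ⊆ Set.range δ := by
      rintro _ ⟨t, rfl⟩
      by_contra ht
      have hj : JoinedIn {γ t}ᶜ (line a b r) (line a b s) :=
        ⟨⟨⟨δ, hδ.continuous⟩, d0, d1⟩, fun u hu => ht ⟨u, hu⟩⟩
      rcases between_mem r s t with h | h
      · exact not_joinedIn_line hab h.1 h.2 hj
      · exact not_joinedIn_line hab h.1 h.2 hj.symm
    exact Set.Subset.antisymm
      (range_subset_range_of_isEmbedding hγ hδ (h0.trans d0.symm) (h1.trans d1.symm) hsub) hsub

lemma joinedIn_compl_zero {x p : StarSpace W} (hx : x b < p b) : JoinedIn {p}ᶜ x (zero ⊥) := by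
  refine joinedIn_of_segment x.supp subset_rfl (supp_zero_subset _) fun t => ⟨b, ?_⟩
  have h0 := t.2.1
  have h1 := t.2.2
  have := x.nonneg b
  rw [zero_apply]
  nlinarith

lemma joinedIn_compl_vertex {x p : StarSpace W} (hx : p b < x b) :
    JoinedIn {p}ᶜ x (CliqueSpace.vertex ⊥ b) := by
  have hb : x b ≠ 0 := (lt_of_le_of_lt (p.nonneg b) hx).ne'
  have hs : x.supp.1 ⊆ (FiniteClique.single ⊥ b).1 := by
    intro c hc
    rw [FiniteClique.coe_single, Finset.mem_singleton]
    by_contra hcb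
    exact mem_supp.1 hc (apply_eq_zero_of_ne hb hcb)
  refine joinedIn_of_segment (FiniteClique.single ⊥ b) hs (supp_vertex b).subset fun t => ⟨b, ?_⟩
  have h0 := t.2.1
  have h1 := t.2.2
  have := x.le_one b
  rw [vertex_apply, if_pos rfl]
  nlinarith

/-- Inner points of the arms have degree two: they are neither leaves nor ramification points. -/
lemma isFiniteDendron [Finite W] [Nontrivial W] : IsFiniteDendron (StarSpace W) where
  toIsDendron := isDendron_and_compactSpace.1
  compact := isDendron_and_compactSpace.2
  finite_vertices := by
    refine ((Set.finite_range (CliqueSpace.vertex (⊥ : SimpleGraph W))).insert (zero ⊥)).subset ?_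
    intro p hp
    rw [Set.mem_insert_iff]
    by_contra! hcon
    obtain ⟨hp0, hpv⟩ := hcon
    obtain ⟨b, hb⟩ : ∃ b, p b ≠ 0 := by
      by_contra! h
      exact hp0 (CliqueSpace.ext h)
    have hpos : 0 < p b := lt_of_le_of_ne (p.nonneg b) hb.symm
    have hlt : p b < 1 := by
      refine lt_of_le_of_ne (p.le_one b) fun h => hpv ⟨b, ?_⟩
      exact (eq_of_apply_eq hb (by rw [h, vertex_apply, if_pos rfl])).symm
    rcases hp with hp | ⟨x, y, z, hx, hy, hz, hxy, hyz, hxz⟩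
    · obtain ⟨a, hab⟩ := exists_ne b
      obtain ⟨r, rfl⟩ := exists_line_right hab fun c hc => apply_eq_zero_of_ne hb hc
      have h0 : (0 : ℝ) < r := by
        rw [line_apply_right hab] at hpos
        simpa using hpos
      rw [line_apply_right hab, max_eq_left h0.le] at hlt
      refine not_joinedIn_line hab (r := ⟨0, by norm_num, by norm_num⟩) (t := r)
        (s := ⟨1, by norm_num, by norm_num⟩) h0.le r.2.2 (hp _ _ ?_ ?_)
      · intro h
        have := congrArg Subtype.val ((isometry_line hab).injective h)
        exact h0.ne this
      · intro h
        have := congrArg Subtype.val ((isometry_line hab).injective h)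
        exact hlt.ne' this
    · have hside : ∀ w : StarSpace W, w ≠ p →
          JoinedIn {p}ᶜ w (zero ⊥) ∨ JoinedIn {p}ᶜ w (CliqueSpace.vertex ⊥ b) := by
        intro w hw
        rcases lt_trichotomy (w b) (p b) with h | h | h
        · exact Or.inl (joinedIn_compl_zero h)
        · exact absurd (eq_of_apply_eq hb h.symm).symm hw
        · exact Or.inr (joinedIn_compl_vertex h)
      rcases hside x hx with h1 | h1 <;> rcases hside y hy with h2 | h2 <;>
        rcases hside z hz with h3 | h3
      · exact hxy (h1.trans h2.symm)
      · exact hxy (h1.trans h2.symm)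
      · exact hxz (h1.trans h3.symm)
      · exact hyz (h2.trans h3.symm)
      · exact hyz (h2.trans h3.symm)
      · exact hxz (h1.trans h3.symm)
      · exact hxy (h1.trans h2.symm)
      · exact hxy (h1.trans h2.symm)

end StarSpace

/-- The restriction of a point of the model to a colour class of `H`. -/
noncomputable def CliqueSpace.colorPart {H : SimpleGraph W} (χ : H.Coloring Bool) (i : Bool)
    (x : CliqueSpace H) : StarSpace W :=
  CliqueSpace.ofFun (FiniteClique.colorPart χ i x.supp) (fun a => if χ a = i then x a else 0)
    (fun a => by split_ifs; exacts [x.mem_Icc a, by simp])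
    (fun a ha => by
      split_ifs with h
      · exact apply_eq_zero fun h' => ha (Finset.mem_filter.2 ⟨h', h⟩)
      · rfl)

lemma CliqueSpace.dist_colorPart {H : SimpleGraph W} (χ : H.Coloring Bool) (x y : CliqueSpace H) :
    dist x y = dist (colorPart χ true x) (colorPart χ true y) +
      dist (colorPart χ false x) (colorPart χ false y) := by
  have hs : ∀ i (z : CliqueSpace H), (colorPart χ i z).supp.1 ⊆ z.supp.1 := fun i z =>
    (supp_ofFun_subset _ _ _ _).trans (Finset.filter_subset _ _)
  have hx : x.supp.1 ⊆ x.supp.1 ∪ y.supp.1 := Finset.subset_union_left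
  have hy : y.supp.1 ⊆ x.supp.1 ∪ y.supp.1 := Finset.subset_union_right
  rw [dist_eq_sum hx hy, dist_eq_sum ((hs _ _).trans hx) ((hs _ _).trans hy),
    dist_eq_sum ((hs _ _).trans hx) ((hs _ _).trans hy), ← Finset.sum_add_distrib]
  refine Finset.sum_congr rfl fun a _ => ?_
  have hap : ∀ i (z : CliqueSpace H), colorPart χ i z a = if χ a = i then z a else 0 :=
    fun i z => rfl
  rw [hap, hap, hap, hap]
  cases χ a <;> simp

/-- The realization of `κ(H)` embeds into the product of two star dendrons. -/
lemma isRamifiedRectilinearPolygon_realizationCells {H : SimpleGraph W} (χ : H.Coloring Bool)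
    [Finite (FiniteClique H)] [Nontrivial W] :
    IsRamifiedRectilinearPolygon (realizationCells (simplexGraph H)) := by
  have : Finite W := Finite.of_injective _ (FiniteClique.single_injective (H := H))
  let e := CliqueSpace.isometryEquivRealization H
  refine ⟨isFiniteRectangularComplex_realizationCells χ, StarSpace W, StarSpace W, inferInstance,
    inferInstance, StarSpace.isFiniteDendron, StarSpace.isFiniteDendron,
    fun w => CliqueSpace.colorPart χ true (e.symm w),
    fun w => CliqueSpace.colorPart χ false (e.symm w), fun x y => ?_⟩
  rw [← e.symm.edist_eq x y, edist_dist, edist_dist, edist_dist,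
    ← ENNReal.ofReal_add dist_nonneg dist_nonneg, CliqueSpace.dist_colorPart χ]

end StarDendron

/-! ### Cutpoints -/

section Cutpoints

open scoped Classical

variable {W : Type u} {H : SimpleGraph W}

namespace CliqueSpace

lemma joinedIn_compl_zero_vertex (hH : H.Connected) (a b : W) :
    JoinedIn {zero H}ᶜ (vertex H a) (vertex H b) := by
  have hne : ∀ a, vertex H a ≠ zero H := fun a h => by
    have : vertex H a a = zero H a := by rw [h]
    rw [vertex_apply, if_pos rfl, zero_apply] at this
    exact one_ne_zero this
  obtain ⟨p⟩ := hH.preconnected a b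
  induction p with
  | nil => exact JoinedIn.refl (hne _)
  | @cons a b c h p ih =>
    refine JoinedIn.trans ?_ ih
    refine joinedIn_of_segment (FiniteClique.pair h) (by simp [supp_vertex]) (by simp [supp_vertex])
      fun t => ?_
    by_cases ht : (t : ℝ) = 1
    · refine ⟨b, ?_⟩
      rw [ht, vertex_apply, vertex_apply, if_pos rfl, zero_apply]
      norm_num
    · refine ⟨a, ?_⟩
      rw [vertex_apply, vertex_apply, if_pos rfl, if_neg h.ne, zero_apply]
      have : 1 - (t : ℝ) ≠ 0 := sub_ne_zero.2 (Ne.symm ht)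
      simpa using this

/-- Away from a point `p ≠ 0` every point is joined to `0`. If the segment to `0` runs through `p`,
then it can be bypassed inside a square that contains it. -/
lemma joinedIn_compl_zero (hn : ∀ a, ∃ b, H.Adj a b) {p x : CliqueSpace H} (hp : p ≠ zero H)
    (hx : x ≠ p) : JoinedIn {p}ᶜ x (zero H) := by
  obtain ⟨a, ha⟩ : ∃ a, p a ≠ 0 := by
    by_contra! h
    exact hp (ext h)
  by_cases hseg : ∀ r : unitInterval, ∃ c, (1 - (r : ℝ)) * x c + r * zero H c ≠ p c
  · exact joinedIn_of_segment x.supp subset_rfl (supp_zero_subset _) hseg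
  push Not at hseg
  obtain ⟨r, hr⟩ := hseg
  simp only [zero_apply, mul_zero, add_zero] at hr
  have hr1 : 1 - (r : ℝ) ≠ 0 := fun h => ha (by rw [← hr, h, zero_mul])
  have hxa : x a ≠ 0 := fun h => ha (by rw [← hr, h, mul_zero])
  have hr0 : (r : ℝ) ≠ 0 := fun h => hx (ext fun c => by rw [← hr, h]; ring)
  have hne : x a ≠ p a := fun h => by
    have h1 := hr a
    rw [← h] at h1
    have h2 : (r : ℝ) * x a = 0 := by linear_combination -h1
    exact (mul_ne_zero hr0 hxa) h2
  have hconst : ∀ t y : ℝ, (1 - t) * y + t * y = y := fun t y => by ring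
  by_cases hb : ∃ b, b ≠ a ∧ p b ≠ 0
  · obtain ⟨b, hba, hb⟩ := hb
    have hs : (single H a (x a) (x.mem_Icc a)).supp.1 ⊆ x.supp.1 := fun c hc => by
      rw [mem_supp, single_apply] at hc
      rw [mem_supp]
      grind
    refine (joinedIn_of_segment (y := single H a (x a) (x.mem_Icc a)) x.supp subset_rfl hs
      fun t => ⟨a, ?_⟩).trans (joinedIn_of_segment x.supp hs (supp_zero_subset _) fun t => ⟨b, ?_⟩)
    · rwa [single_apply, if_pos rfl, hconst]
    · rw [single_apply, if_neg hba, zero_apply, mul_zero, mul_zero, add_zero]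
      exact hb.symm
  · push Not at hb
    obtain ⟨b, hab⟩ := hn a
    have hs : x.supp.1 ⊆ (FiniteClique.pair hab).1 := fun c hc => by
      rw [mem_supp] at hc
      have h1 : c = a := by
        by_contra hca
        exact (mul_ne_zero hr1 hc) ((hr c).trans (hb c hca))
      simp [h1]
    let y : CliqueSpace H := ofFun (FiniteClique.pair hab)
      (fun c => if c = a then x a else if c = b then 1 else 0)
      (fun c => by split_ifs; exacts [x.mem_Icc a, by simp, by simp])
      (fun c hc => by
        simp only [FiniteClique.coe_pair, Finset.mem_insert, Finset.mem_singleton, not_or] at hc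
        rw [if_neg hc.1, if_neg hc.2])
    have hys : y.supp.1 ⊆ (FiniteClique.pair hab).1 := supp_ofFun_subset _ _ _ _
    have hya : y a = x a := if_pos rfl
    have hyb : y b = 1 := (if_neg hab.ne').trans (if_pos rfl)
    have hvs : (vertex H b).supp.1 ⊆ (FiniteClique.pair hab).1 := by simp [supp_vertex]
    refine ((joinedIn_of_segment _ hs hys fun t => ⟨a, ?_⟩).trans
      (joinedIn_of_segment _ hys hvs fun t => ⟨b, ?_⟩)).trans
      (joinedIn_of_segment _ hvs (supp_zero_subset _) fun t => ⟨a, ?_⟩)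
    · rwa [hya, hconst]
    · rw [hyb, vertex_apply, if_pos rfl, hconst, hb b hab.ne']
      exact one_ne_zero
    · rw [vertex_apply, if_neg hab.ne, zero_apply, mul_zero, mul_zero, add_zero]
      exact ha.symm

lemma isPathConnected_compl_singleton (hH : H.Connected) (hn : ∀ a, ∃ b, H.Adj a b)
    (p : CliqueSpace H) : IsPathConnected ({p}ᶜ : Set (CliqueSpace H)) := by
  by_cases hp : p = zero H
  · subst hp
    obtain ⟨a⟩ := hH.nonempty
    have h1 := joinedIn_compl_zero_vertex hH
    refine ⟨vertex H a, (h1 a a).source_mem, fun {x} hx => ?_⟩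
    obtain ⟨b, hb⟩ : ∃ b, x b ≠ 0 := by
      by_contra! h
      exact hx (ext h)
    refine (h1 a b).trans (joinedIn_of_segment x.supp ?_ subset_rfl fun t => ⟨b, ?_⟩)
    · simpa [supp_vertex, mem_supp] using hb
    · have h0 := t.2.1
      have h1 := t.2.2
      have hpos := lt_of_le_of_ne (x.nonneg b) hb.symm
      rw [vertex_apply, if_pos rfl, zero_apply]
      refine ne_of_gt ?_
      rcases h0.eq_or_lt with h | h
      · rw [← h]; norm_num
      · have := mul_pos h hpos
        linarith
  · exact ⟨zero H, fun h => hp h.symm, fun {x} hx => (joinedIn_compl_zero hn hp hx).symm⟩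

end CliqueSpace

lemma hasNoCutpoints_realization (hH : H.Connected) (hn : ∀ a, ∃ b, H.Adj a b) :
    HasNoCutpoints (Realization (simplexGraph H)) := by
  intro p
  let e := CliqueSpace.isometryEquivRealization H
  have h := (CliqueSpace.isPathConnected_compl_singleton hH hn (e.symm p)).isConnected.image e
    e.continuous.continuousOn
  have himg : e '' {e.symm p}ᶜ = {p}ᶜ := by
    rw [Set.image_compl_eq e.bijective, Set.image_singleton, e.apply_symm_apply]
  rwa [himg] at h

end Cutpoints

theorem theorem6 (Γ : Type u) [Group Γ] :
    ∃ (V : Type u) (G : SimpleGraph V),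
      (∃ (W : Type u) (F : SimpleGraph W),
        Nonempty (Γ ≃* (F ≃g F)) ∧ (Finite Γ → Finite W) ∧
          Nonempty (G ≃g simplexGraph (simplexGraph F))) ∧
      Nonempty (Γ ≃* (G ≃g G)) ∧
      IsTwoConnected G ∧
      IsPartialDoubleTree G ∧
      G.radius = 2 ∧
      (Finite Γ → Finite V) ∧
      Nonempty ((G ≃g G) ≃* (Realization G ≃ᵢ Realization G)) ∧
      (Finite V →
        IsRamifiedRectilinearPolygon (realizationCells G) ∧ HasNoCutpoints (Realization G)) := by
  obtain ⟨W, F, ⟨e⟩, hfin, ⟨χ⟩, h3, hn⟩ := exists_bipartite_graph_aut Γ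
  have hne : ∃ a b : W, a ≠ b := by
    obtain ⟨a, b, hab, -⟩ := h3
    exact ⟨_, _, (hab 0).ne⟩
  have χ' := simplexGraphColoring F
  have h3' := h3.simplexGraph
  have hconn := simplexGraph_connected F
  have h2 : ∀ s : FiniteClique F, ∃ t r, t ≠ r ∧ (simplexGraph F).Adj s t ∧
      (simplexGraph F).Adj s r := simplexGraph_exists_two_neighbors hne hn
  have hn' : ∀ s : FiniteClique F, ∃ t, (simplexGraph F).Adj s t := fun s => by
    obtain ⟨t, -, -, ht, -⟩ := h2 s
    exact ⟨t, ht⟩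
  have : Nontrivial (FiniteClique F) := by
    obtain ⟨a, b, hab⟩ := hne
    exact ⟨_, _, fun h => hab (FiniteClique.single_injective h)⟩
  refine ⟨_, simplexGraph (simplexGraph F), ⟨W, F, ⟨e⟩, hfin, ⟨.refl⟩⟩,
    ⟨(e.trans (simplexGraphAutEquiv χ h3)).trans (simplexGraphAutEquiv χ' h3')⟩,
    simplexGraph_isTwoConnected χ' h3' hconn, simplexGraph_isPartialDoubleTree χ',
    simplexGraph_radius χ' h3', fun hΓ => ?_, ⟨simplexGraphAutEquivIsometry χ' h3' h2⟩,
    fun _ => ⟨isRamifiedRectilinearPolygon_realizationCells χ',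
      hasNoCutpoints_realization hconn hn'⟩⟩
  have := hfin hΓ
  infer_instance
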